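/- Let $\mathcal C=[0,1]^3\subset\mathbb R^3$ be the unit cube with facets labelled $1,\dots,6$ so that the pairs of parallel facets are $\{1,2\}$, $\{3,4\}$, $\{5,6\}$. Let $\Gamma$ be the right-angled Coxeter group of $\mathcal C$: it has one generator $r_i$ of order two for each facet $i$, with $r_ir_j=r_jr_i$ whenever the facets $i,j$ are not parallel and no further relations, and it acts on $\mathbb R^3$ with $r_i$ acting as the reflection in the plane of facet $i$. Let $k\ge 3$ and let $\lambda:\{1,\dots,6\}\to\mathbb F_2^k$ be a proper colouring, that is, the colours of any facets with a common point are linearly independent. Write $\lambda:\Gamma\to\mathbb F_2^k$ also for the homomorphism $r_i\mapsto\lambda(i)$, and let $M_\lambda=\mathbb R^3/\ker\lambda$ be the associated manifold. Let $\Lambda$ be the $k\times 6$ matrix over $\mathbb F_2$ with columns $\lambda(1),\dots,\lambda(6)$, let $\mathrm{Row}(\Lambda)\subseteq\mathbb F_2^6$ be its row space, and let $T=\{e_1+e_2,\;e_3+e_4,\;e_5+e_6\}\subset\mathbb F_2^6$, where $e_i$ is the $i$-th standard basis vector. Assume that $M_\lambda$ is orientable. Then: (i) if $\mathrm{Row}(\Lambda)\cap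 T=T$, then $M_\lambda$ is homeomorphic to the $3$-torus $(\mathbb R/\mathbb Z)^3$; (ii) if $\emptyset\ne\mathrm{Row}(\Lambda)\cap T\subsetneq T$, then $M_\lambda$ is homeomorphic to the half-twist manifold $\mathfrak F_2$ (the orientable flat circle bundle over the Klein bottle), which is the quotient of $\mathbb R^3$ by the group generated by the unit translations along the three coordinate axes and $(x,y,z)\mapsto(x+\tfrac12,-y,-z)$; (iii) if $\mathrm{Row}(\Lambda)\cap T=\emptyset$, then $M_\lambda$ is homeomorphic to the Hantzsche–Wendt manifold $\mathfrak F_6$, which is the quotient of $\mathbb R^3$ by the group generated by the unit translations along the three coordinate axes and the three maps $(x,y,z)\mapsto(x+\tfrac12,-y+\tfrac12,-z)$, $(x,y,z)\mapsto(-x,y+\tfrac12,-z+\tfrac12)$, $(x,y,z)\mapsto(-x+\tfrac12,-y,z+\tfrac12)$. -/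

import Mathlib

open scoped ContDiff

noncomputable section

namespace CubeColouring

/-! ### Isometries of Euclidean 3-space and orbit spaces -/

/-- Euclidean `3`-space. -/
abbrev E3 : Type := EuclideanSpace ℝ (Fin 3)

/-- The isometry `x ↦ (s₀ x₀ + v₀, s₁ x₁ + v₁, s₂ x₂ + v₂)` of Euclidean `3`-space,
where each `sⱼ` is `1` or `-1`. -/
def signedIsometry (s : Fin 3 → ℤˣ) (v : Fin 3 → ℝ) : E3 ≃ᵢ E3 where
  toFun x := WithLp.toLp 2 fun j => ((s j : ℤ) : ℝ) * x j + v j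
  invFun y := WithLp.toLp 2 fun j => ((s j : ℤ) : ℝ) * (y j - v j)
  left_inv x := by
    ext j
    rcases Int.units_eq_one_or (s j) with h | h <;> simp [h]
  right_inv y := by
    ext j
    rcases Int.units_eq_one_or (s j) with h | h <;> simp [h]
  isometry_toFun := by
    refine Isometry.of_dist_eq fun x y => ?_
    simp only [EuclideanSpace.dist_eq]
    congr 1
    refine Finset.sum_congr rfl fun j _ => ?_
    rcases Int.units_eq_one_or (s j) with h | h <;> simp [h]

/-- Two points are equivalent when they lie in the same orbit of the group `G` of isometries. -/
def orbitSetoid (G : Subgroup (E3 ≃ᵢ E3)) : Setoid E3 where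
  r x y := ∃ g ∈ G, g x = y
  iseqv :=
    { refl := fun x => ⟨1, G.one_mem, rfl⟩
      symm := by
        rintro x y ⟨g, hg, rfl⟩
        exact ⟨g⁻¹, G.inv_mem hg, g.symm_apply_apply x⟩
      trans := by
        rintro x y z ⟨g, hg, rfl⟩ ⟨h, hh, rfl⟩
        exact ⟨h * g, G.mul_mem hh hg, rfl⟩ }

/-- The orbit space `ℝ³ / G`, with the quotient topology. -/
abbrev OrbitSpace (G : Subgroup (E3 ≃ᵢ E3)) : Type := Quotient (orbitSetoid G)

/-- The projection `ℝ³ → ℝ³ / G`. -/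
def orbitProj (G : Subgroup (E3 ≃ᵢ E3)) (x : E3) : OrbitSpace G := Quotient.mk (orbitSetoid G) x

/-- A chart of `ℝ³ / G` belongs to the smooth structure of the quotient manifold when its
composition with the projection is smooth with invertible differential, that is, a local
diffeomorphism. -/
def IsSmoothChart (G : Subgroup (E3 ≃ᵢ E3)) (φ : OpenPartialHomeomorph (OrbitSpace G) E3) : Prop :=
  ContDiffOn ℝ ∞ (φ ∘ orbitProj G) (orbitProj G ⁻¹' φ.source) ∧
    ∀ x ∈ orbitProj G ⁻¹' φ.source, (fderiv ℝ (φ ∘ orbitProj G) x).det ≠ 0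

/-- The quotient manifold `ℝ³ / G` is orientable: it is covered by smooth charts all of whose
transition maps have positive Jacobian determinant. -/
def IsOrientable (G : Subgroup (E3 ≃ᵢ E3)) : Prop :=
  ∃ A : Set (OpenPartialHomeomorph (OrbitSpace G) E3),
    (∀ p : OrbitSpace G, ∃ φ ∈ A, p ∈ φ.source) ∧
    (∀ φ ∈ A, IsSmoothChart G φ) ∧
    ∀ φ ∈ A, ∀ ψ ∈ A, ∀ y ∈ (φ.symm.trans ψ).source,
      0 < (fderiv ℝ (φ.symm.trans ψ) y).det

/-! ### The three flat manifolds -/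

/-- The translation by the `j`-th standard basis vector. -/
def unitTranslation (j : Fin 3) : E3 ≃ᵢ E3 := signedIsometry 1 (Pi.single j 1)

/-- The group generated by the unit translations and the half-turn screw motion
`(x, y, z) ↦ (x + 1/2, -y, -z)`. -/
def halfTwistGroup : Subgroup (E3 ≃ᵢ E3) :=
  Subgroup.closure (Set.range unitTranslation ∪ {signedIsometry ![1, -1, -1] ![1 / 2, 0, 0]})

/-- The group generated by the unit translations and the three half-turn screw motions
`(x, y, z) ↦ (x + 1/2, -y + 1/2, -z)`, `(x, y, z) ↦ (-x, y + 1/2, -z + 1/2)` and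
`(x, y, z) ↦ (-x + 1/2, -y, z + 1/2)`, whose axes are parallel to the three coordinate axes and
pairwise disjoint. -/
def hantzscheWendtGroup : Subgroup (E3 ≃ᵢ E3) :=
  Subgroup.closure (Set.range unitTranslation ∪
    {signedIsometry ![1, -1, -1] ![1 / 2, 1 / 2, 0],
      signedIsometry ![-1, 1, -1] ![0, 1 / 2, 1 / 2],
      signedIsometry ![-1, -1, 1] ![1 / 2, 0, 1 / 2]})

/-- The `3`-torus `(ℝ/ℤ)³`. -/
abbrev ThreeTorus : Type := UnitAddTorus (Fin 3)

/-- The half-twist manifold: the mapping torus of the half-turn `p ↦ -p` of the `2`-torus. -/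
abbrev HalfTwistManifold : Type := OrbitSpace halfTwistGroup

/-- The Hantzsche–Wendt manifold. -/
abbrev HantzscheWendtManifold : Type := OrbitSpace hantzscheWendtGroup

/-! ### The unit cube, its facets and its reflection group

The facets `1, …, 6` are indexed by `0, …, 5 : Fin 6`; the pairs of parallel facets are
`{0, 1}`, `{2, 3}` and `{4, 5}`. -/

/-- The coordinate that is constant on the `i`-th facet. -/
def axis : Fin 6 → Fin 3 := ![0, 0, 1, 1, 2, 2]

/-- The value of that coordinate on the `i`-th facet. -/
def level : Fin 6 → ℝ := ![0, 1, 0, 1, 0, 1]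

/-- The unit cube `[0,1]³`. -/
def cube : Set E3 := {x | ∀ j, x j ∈ Set.Icc (0 : ℝ) 1}

/-- The `i`-th facet of the cube. -/
def facet (i : Fin 6) : Set E3 := {x ∈ cube | x (axis i) = level i}

/-- The orthogonal reflection in the plane of the `i`-th facet: the constant coordinate `t` of the
facet goes to `2 * level i - t`, the other two coordinates are fixed. -/
def facetReflection (i : Fin 6) : E3 ≃ᵢ E3 :=
  signedIsometry (Function.update 1 (axis i) (-1)) (Pi.single (axis i) (2 * level i))

/-- The right-angled Coxeter matrix of the cube: reflections in two distinct facets commute if the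
facets meet, and there is no relation (entry `0`) if they are parallel. -/
def cubeMatrix : CoxeterMatrix (Fin 6) where
  M := Matrix.of fun i j => if i = j then 1 else if axis i = axis j then 0 else 2
  isSymm := by ext i j; fin_cases i <;> fin_cases j <;> rfl
  diagonal i := by simp
  off_diagonal i j h := by simp only [Matrix.of_apply, if_neg h]; split_ifs <;> simp

/-- The right-angled Coxeter group `Γ` of the cube, with one generator for each facet. -/
abbrev CoxeterGroup : Type := cubeMatrix.Group

theorem facetReflection_isLiftable : cubeMatrix.IsLiftable facetReflection := by
  intro i j
  have h2 : cubeMatrix i j = if i = j then 1 else if axis i = axis j then 0 else 2 := rfl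
  rw [h2]
  split_ifs with h h'
  · subst h
    ext x m
    by_cases hm : m = axis i
    · subst hm; simp [facetReflection, signedIsometry]
    · simp [facetReflection, signedIsometry, hm]
  · exact pow_zero _
  · ext x m
    have h'' := Ne.symm h'
    by_cases hm : m = axis i
    · subst hm; simp [facetReflection, signedIsometry, pow_two, h']
    · by_cases hn : m = axis j
      · subst hn; simp [facetReflection, signedIsometry, pow_two, h'']
      · simp [facetReflection, signedIsometry, pow_two, hm, hn]

/-- The action of the Coxeter group of the cube on Euclidean space, the generator of a facet acting
as the reflection in that facet. -/
def reflectionAction : CoxeterGroup →* (E3 ≃ᵢ E3) :=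
  cubeMatrix.toCoxeterSystem.lift ⟨facetReflection, facetReflection_isLiftable⟩

/-! ### Colourings -/

variable {k : ℕ}

theorem colouring_isLiftable (c : Fin 6 → Fin k → ZMod 2) :
    cubeMatrix.IsLiftable fun i => Multiplicative.ofAdd (c i) := by
  intro i j
  have h2 : cubeMatrix i j = if i = j then 1 else if axis i = axis j then 0 else 2 := rfl
  rw [h2]
  have h3 : ∀ x : Multiplicative (Fin k → ZMod 2), x ^ 2 = 1 := fun x => by
    rw [pow_two]
    exact funext fun a => CharTwo.add_self_eq_zero (x.toAdd a)
  split_ifs with h h'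
  · subst h
    rw [pow_one, ← pow_two, h3]
  · exact pow_zero _
  · exact h3 _

/-- The homomorphism `Γ → 𝔽₂ᵏ` defined by a colouring `c`, which sends the generator of the `i`-th
facet to `c i`. -/
def colouringHom (c : Fin 6 → Fin k → ZMod 2) : CoxeterGroup →* Multiplicative (Fin k → ZMod 2) :=
  cubeMatrix.toCoxeterSystem.lift ⟨_, colouring_isLiftable c⟩

/-- The kernel of the homomorphism of a colouring, as a group of isometries of `ℝ³`. -/
def kernelGroup (c : Fin 6 → Fin k → ZMod 2) : Subgroup (E3 ≃ᵢ E3) :=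
  (colouringHom c).ker.map reflectionAction

/-- The space `M_c = ℝ³ / ker c`. -/
abbrev ColouringSpace (c : Fin 6 → Fin k → ZMod 2) : Type := OrbitSpace (kernelGroup c)

/-- A colouring is proper when the colours of any facets with a common point (a simplex of the dual
octahedron) are linearly independent. -/
def IsProper (c : Fin 6 → Fin k → ZMod 2) : Prop :=
  ∀ S : Finset (Fin 6), (⋂ i ∈ S, facet i).Nonempty →
    LinearIndependent (ZMod 2) fun i : S => c i

/-- The defining matrix of a colouring: its `i`-th column is the colour of the `i`-th facet. -/
def definingMatrix (c : Fin 6 → Fin k → ZMod 2) : Matrix (Fin k) (Fin 6) (ZMod 2) :=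
  Matrix.of fun a i => c i a

/-- The row space of a matrix. -/
def rowSpace (L : Matrix (Fin k) (Fin 6) (ZMod 2)) : Submodule (ZMod 2) (Fin 6 → ZMod 2) :=
  Submodule.span (ZMod 2) (Set.range L.row)

/-- The `i`-th standard basis vector of `𝔽₂⁶`. -/
def e (i : Fin 6) : Fin 6 → ZMod 2 := Pi.single i 1

/-- The set `T = {e₁ + e₂, e₃ + e₄, e₅ + e₆}`, with indices starting from `0`. -/
def T : Set (Fin 6 → ZMod 2) := {e 0 + e 1, e 2 + e 3, e 4 + e 5}

end CubeColouring

end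

/-!
The elements of the Coxeter group of the cube act on `ℝ³` as the motions
`x ↦ ((-1) ^ aⱼ xⱼ + 2 wⱼ)ⱼ` with `a ∈ 𝔽₂³` and `w ∈ ℤ³`, and the colour of such a motion is
`∑ⱼ wⱼ (λ(2j) + λ(2j+1)) + aⱼ λ(2j)` (facets numbered from `0`). So the group `ker λ` is determined
by the space `K ⊆ 𝔽₂³ × 𝔽₂³` of the pairs `(a, w mod 2)` whose colour vanishes (`kernelGroup_eq`).
The half-twist group and the Hantzsche–Wendt group have the same shape, with `w / 2` in place of
`2 w` (`halfTwistGroup_eq`, `hantzscheWendtGroup_eq`).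

The hypotheses become conditions on `K`.
* The quotient is orientable, so `a₀ + a₁ + a₂ = 0` on `K`: the sign of the Jacobian determinant of
  an oriented chart composed with the projection is constant on `ℝ³`
  (`prod_eq_one_of_isOrientable`).
* The colouring is proper, so every nonzero element of `K` has an index `j` with `aⱼ = 0`, `wⱼ = 1`:
  otherwise it is a linear relation between the colours of three facets through one vertex
  (`IsProper.exists_eq_zero_and_eq_one`). In other words, `ker λ` acts freely.
* The row space is the annihilator of `K`, so it contains the `j`-th element of `T` if and only if
  `aⱼ = 0` on `K` (`e_add_e_mem_rowSpace_iff`).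

Hence the signs which occur in `K` form a subspace of `{000, 011, 101, 110}`. If `T` lies in the row
space, only `000` occurs and the group is a lattice of translations. If some but not all elements
of `T` do, there is one nontrivial sign vector, say `011`; then properness forces the translations to
be the direct sum of `4 ℤ` along the axis and a lattice in the plane, and the half-turn commutes
with the linear map that makes this lattice standard. If no element of `T` lies in the row space, all
four sign vectors occur, and properness leaves no translations besides `4 ℤ³` and determines the
translation parts as the cyclic shift of the signs up to the choice of the origin
(`exists_mem_iff_cyclic_shift`). In each case an affine map conjugates the group to its model.
-/

namespace CubeColouring

/-! ### Groups of signed motions -/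

/-- The sign `(-1) ^ a` of a residue class `a` modulo `2`. -/
def sgn (a : ZMod 2) : ℤˣ := if a = 0 then 1 else -1

theorem sgn_zero : sgn 0 = 1 := rfl

theorem sgn_one : sgn 1 = -1 := rfl

theorem sgn_add : ∀ a b : ZMod 2, sgn (a + b) = sgn a * sgn b := by decide

theorem zmod_two_cases (a : ZMod 2) : a = 0 ∨ a = 1 := by
  revert a; decide

theorem sgn_mul_self (a : ZMod 2) : ((sgn a : ℤ) : ℝ) * ((sgn a : ℤ) : ℝ) = 1 := by
  rcases zmod_two_cases a with rfl | rfl <;> simp [sgn_zero, sgn_one]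

theorem cast_sgn_mul (a : ZMod 2) (n : ℤ) : (((sgn a : ℤ) * n : ℤ) : ZMod 2) = n := by
  rcases zmod_two_cases a with rfl | rfl <;> simp [sgn_zero, sgn_one]

/-- The isometry `x ↦ ((-1) ^ aⱼ xⱼ + vⱼ)ⱼ`: signed motions with additively encoded signs. -/
def motion (a : Fin 3 → ZMod 2) (v : Fin 3 → ℝ) : E3 ≃ᵢ E3 :=
  signedIsometry (fun j => sgn (a j)) v

theorem motion_apply (a : Fin 3 → ZMod 2) (v : Fin 3 → ℝ) (x : E3) (j : Fin 3) :
    motion a v x j = ((sgn (a j) : ℤ) : ℝ) * x j + v j := rfl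

theorem motion_mul (a b : Fin 3 → ZMod 2) (v w : Fin 3 → ℝ) :
    motion a v * motion b w = motion (a + b) fun j => v j + ((sgn (a j) : ℤ) : ℝ) * w j := by
  ext x j
  have h : (motion a v * motion b w) x = motion a v (motion b w x) := rfl
  rw [h]
  simp only [motion_apply, Pi.add_apply, sgn_add]
  push_cast
  ring

theorem motion_zero : motion 0 0 = 1 := by
  ext x j
  simp [motion_apply, sgn_zero]

theorem motion_inv (a : Fin 3 → ZMod 2) (v : Fin 3 → ℝ) :
    (motion a v)⁻¹ = motion a fun j => -(((sgn (a j) : ℤ) : ℝ) * v j) := by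
  refine inv_eq_of_mul_eq_one_right ?_
  rw [motion_mul, ← motion_zero, show a + a = 0 from funext fun j => CharTwo.add_self_eq_zero (a j)]
  congr 1
  funext j
  have := sgn_mul_self (a j)
  simp only [Pi.zero_apply]
  linear_combination (- v j) * this

/-- The group of the motions with signs `(-1) ^ a` and translation vector `r w`, `w ∈ ℤ³`, where
the pair of `a` and of the class of `w` modulo `2` lies in `K`. The kernel of a colouring, the
half-twist group and the Hantzsche–Wendt group are all of this form. -/
def motionGroup (r : ℝ) (K : AddSubgroup ((Fin 3 → ZMod 2) × (Fin 3 → ZMod 2))) :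
    Subgroup (E3 ≃ᵢ E3) where
  carrier := {g | ∃ (a : Fin 3 → ZMod 2) (w : Fin 3 → ℤ),
    (a, fun j => (w j : ZMod 2)) ∈ K ∧ g = motion a fun j => r * w j}
  one_mem' := by
    refine ⟨0, 0, ?_, ?_⟩
    · convert K.zero_mem using 1
      exact Prod.ext rfl (funext fun j => by simp)
    · rw [← motion_zero]
      congr 1
      funext j
      simp
  mul_mem' := by
    rintro _ _ ⟨a, w, h, rfl⟩ ⟨b, u, h', rfl⟩
    refine ⟨a + b, fun j => w j + sgn (a j) * u j, ?_, ?_⟩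
    · convert K.add_mem h h' using 1
      rw [Prod.mk_add_mk]
      congr 1
      funext j
      simp only [Int.cast_add, cast_sgn_mul, Pi.add_apply]
    · rw [motion_mul]
      congr 1
      funext j
      push_cast
      ring
  inv_mem' := by
    rintro _ ⟨a, w, h, rfl⟩
    refine ⟨a, fun j => -(sgn (a j) * w j), ?_, ?_⟩
    · convert h using 3 with j
      rw [Int.cast_neg, cast_sgn_mul, CharTwo.neg_eq]
    · rw [motion_inv]
      congr 1
      funext j
      push_cast
      ring

theorem mem_motionGroup {r : ℝ} {K : AddSubgroup ((Fin 3 → ZMod 2) × (Fin 3 → ZMod 2))}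
    {g : E3 ≃ᵢ E3} : g ∈ motionGroup r K ↔ ∃ (a : Fin 3 → ZMod 2) (w : Fin 3 → ℤ),
      (a, fun j => (w j : ZMod 2)) ∈ K ∧ g = motion a fun j => r * w j := Iff.rfl

theorem exists_motionGroup_apply_eq {r : ℝ}
    {K : AddSubgroup ((Fin 3 → ZMod 2) × (Fin 3 → ZMod 2))} {x y : E3} :
    (∃ g ∈ motionGroup r K, g x = y) ↔ ∃ (a : Fin 3 → ZMod 2) (w : Fin 3 → ℤ),
      (a, fun j => (w j : ZMod 2)) ∈ K ∧ ∀ j, y j = ((sgn (a j) : ℤ) : ℝ) * x j + r * w j := by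
  constructor
  · rintro ⟨g, ⟨a, w, h, rfl⟩, rfl⟩
    exact ⟨a, w, h, fun j => rfl⟩
  · rintro ⟨a, w, h, hy⟩
    refine ⟨_, ⟨a, w, h, rfl⟩, ?_⟩
    ext j
    exact (hy j).symm

theorem motion_zero_mem_of_single_mem {H : Subgroup (E3 ≃ᵢ E3)} {r : ℝ}
    (h : ∀ j, motion 0 (Pi.single j r) ∈ H) (n : Fin 3 → ℤ) : motion 0 (fun j => r * n j) ∈ H := by
  let P : AddSubgroup (Fin 3 → ℤ) :=
    { carrier := {n | motion 0 (fun j => r * n j) ∈ H}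
      zero_mem' := by
        change motion 0 _ ∈ H
        convert H.one_mem using 1
        rw [← motion_zero]
        congr 1
        funext j
        simp
      add_mem' := by
        intro n m hn hm
        have := H.mul_mem hn hm
        rw [motion_mul, add_zero] at this
        change motion 0 _ ∈ H
        convert this using 2
        funext j
        simp [sgn_zero, mul_add]
      neg_mem' := by
        intro n hn
        have := H.inv_mem hn
        rw [motion_inv] at this
        change motion 0 _ ∈ H
        convert this using 2
        funext j
        simp [sgn_zero] }
  suffices n ∈ P from this
  refine AddSubgroup.pi_mem_of_single_mem n fun j => ?_
  have h1 : Pi.single j 1 ∈ P := by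
    change motion 0 _ ∈ H
    convert h j using 2
    funext i
    rcases eq_or_ne i j with rfl | hij
    · simp
    · simp [hij]
  have := P.zsmul_mem h1 (n j)
  rwa [← Pi.single_smul, smul_eq_mul, mul_one] at this

/-- To contain the group of motions attached to the space generated by `S`, it is enough to contain
the translations by `2 r eⱼ` and one motion for each element of `S`. -/
theorem motionGroup_closure_le {r : ℝ} {S : Set ((Fin 3 → ZMod 2) × (Fin 3 → ZMod 2))}
    {H : Subgroup (E3 ≃ᵢ E3)} (ht : ∀ j, motion 0 (Pi.single j (r * 2)) ∈ H)
    (hS : ∀ p ∈ S, motion p.1 (fun j => r * ((p.2 j).val : ℤ)) ∈ H) :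
    motionGroup r (AddSubgroup.closure S) ≤ H := by
  have even : ∀ w : Fin 3 → ℤ, (∀ j, (w j : ZMod 2) = 0) → motion 0 (fun j => r * w j) ∈ H := by
    intro w hw
    choose n hn using fun j => (ZMod.intCast_zmod_eq_zero_iff_dvd (w j) 2).1 (hw j)
    convert motion_zero_mem_of_single_mem ht n using 3 with j
    rw [hn]
    push_cast
    ring
  suffices key : ∀ p ∈ AddSubgroup.closure S, ∀ w : Fin 3 → ℤ, (∀ j, (w j : ZMod 2) = p.2 j) →
      motion p.1 (fun j => r * w j) ∈ H by
    rintro _ ⟨a, w, h, rfl⟩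
    exact key _ h w fun j => rfl
  intro p hp
  induction hp using AddSubgroup.closure_induction with
  | mem p hp =>
    intro w hw
    have h1 := H.mul_mem (even (fun j => w j - ((p.2 j).val : ℤ)) fun j => by simp [hw j])
      (hS p hp)
    rw [motion_mul, zero_add] at h1
    convert h1 using 2
    funext j
    simp only [Pi.zero_apply, sgn_zero]
    push_cast
    ring
  | zero => exact fun w hw => even w hw
  | add p q _ _ hp hq =>
    intro w hw
    have h1 := H.mul_mem (hp (fun j => ((p.2 j).val : ℤ)) fun j => by simp)
      (hq (fun j => sgn (p.1 j) * (w j - ((p.2 j).val : ℤ))) fun j => by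
        rw [cast_sgn_mul]; simp [hw j])
    rw [motion_mul] at h1
    change motion (p.1 + q.1) _ ∈ H
    convert h1 using 2
    funext j
    have := sgn_mul_self (p.1 j)
    push_cast
    linear_combination (-(r * (w j - (p.2 j).val))) * this
  | neg p _ hp =>
    rwa [show -p = p from Prod.ext (funext fun j => CharTwo.neg_eq _)
      (funext fun j => CharTwo.neg_eq _)]

/-! ### The model groups as groups of motions -/

theorem signedIsometry_eq_motion {s : Fin 3 → ℤˣ} {a : Fin 3 → ZMod 2} {v w : Fin 3 → ℝ}
    (h : ∀ j, s j = sgn (a j)) (h' : ∀ j, v j = w j) : signedIsometry s v = motion a w := by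
  obtain rfl : s = fun j => sgn (a j) := funext h
  obtain rfl : v = w := funext h'
  rfl

theorem unitTranslation_eq (j : Fin 3) : unitTranslation j = motion 0 (Pi.single j (1 / 2 * 2)) :=
  signedIsometry_eq_motion (fun j => rfl) fun i => by norm_num

/-- The space of signs and half-integral translation parts of the half-twist group. -/
def halfTwistSpace : AddSubgroup ((Fin 3 → ZMod 2) × (Fin 3 → ZMod 2)) where
  carrier := {p | p.1 0 = 0 ∧ p.1 1 = p.2 0 ∧ p.1 2 = p.2 0 ∧ p.2 1 = 0 ∧ p.2 2 = 0}
  zero_mem' := by simp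
  add_mem' := by
    rintro p q ⟨h0, h1, h2, h3, h4⟩ ⟨h0', h1', h2', h3', h4'⟩
    simp [*]
  neg_mem' := by
    rintro p ⟨h0, h1, h2, h3, h4⟩
    simp [*]

theorem mem_halfTwistSpace {p : (Fin 3 → ZMod 2) × (Fin 3 → ZMod 2)} : p ∈ halfTwistSpace ↔
    p.1 0 = 0 ∧ p.1 1 = p.2 0 ∧ p.1 2 = p.2 0 ∧ p.2 1 = 0 ∧ p.2 2 = 0 := Iff.rfl

/-- The space of signs and half-integral translation parts of the Hantzsche–Wendt group: the
translation part is the cyclic shift of the signs. -/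
def hantzscheWendtSpace : AddSubgroup ((Fin 3 → ZMod 2) × (Fin 3 → ZMod 2)) where
  carrier := {p | p.1 0 + p.1 1 + p.1 2 = 0 ∧ p.2 0 = p.1 1 ∧ p.2 1 = p.1 2 ∧ p.2 2 = p.1 0}
  zero_mem' := by simp
  add_mem' := by
    rintro p q ⟨h0, h1, h2, h3⟩ ⟨h0', h1', h2', h3'⟩
    refine ⟨?_, by simp [*], by simp [*], by simp [*]⟩
    simp only [Prod.fst_add, Pi.add_apply]
    linear_combination h0 + h0'
  neg_mem' := by
    rintro p ⟨h0, h1, h2, h3⟩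
    refine ⟨?_, by simp [*], by simp [*], by simp [*]⟩
    simp only [Prod.fst_neg, Pi.neg_apply]
    linear_combination -h0

theorem mem_hantzscheWendtSpace {p : (Fin 3 → ZMod 2) × (Fin 3 → ZMod 2)} :
    p ∈ hantzscheWendtSpace ↔
      p.1 0 + p.1 1 + p.1 2 = 0 ∧ p.2 0 = p.1 1 ∧ p.2 1 = p.1 2 ∧ p.2 2 = p.1 0 := Iff.rfl

theorem unitTranslation_mem_motionGroup (K : AddSubgroup ((Fin 3 → ZMod 2) × (Fin 3 → ZMod 2)))
    (j : Fin 3) : unitTranslation j ∈ motionGroup (1 / 2) K := by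
  refine ⟨0, Pi.single j 2, ?_, ?_⟩
  · convert K.zero_mem using 1
    refine Prod.ext rfl (funext fun i => ?_)
    rcases eq_or_ne i j with rfl | hij
    · change ((Pi.single i 2 : Fin 3 → ℤ) i : ZMod 2) = 0
      rw [Pi.single_eq_same]
      exact (by decide : ((2 : ℤ) : ZMod 2) = 0)
    · simp [hij]
  · rw [unitTranslation_eq]
    congr 1
    funext i
    rcases eq_or_ne i j with rfl | hij
    · simp
    · simp [hij]

theorem halfTwistGroup_eq : halfTwistGroup = motionGroup (1 / 2) halfTwistSpace := by
  refine le_antisymm ?_ ?_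
  · refine (Subgroup.closure_le _).2 ?_
    rintro _ (⟨j, rfl⟩ | rfl)
    · exact unitTranslation_mem_motionGroup _ j
    · refine ⟨![0, 1, 1], ![1, 0, 0], by simp [mem_halfTwistSpace], signedIsometry_eq_motion ?_ ?_⟩
      · intro j; fin_cases j <;> rfl
      · intro j; fin_cases j <;> simp
  · have : halfTwistSpace = AddSubgroup.closure {(![0, 1, 1], ![1, 0, 0])} := by
      refine le_antisymm ?_ ((AddSubgroup.closure_le _).2 ?_)
      · rintro ⟨a, w⟩ ⟨h0, h1, h2, h3, h4⟩
        rcases zmod_two_cases (w 0) with h | h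
        · convert AddSubgroup.zero_mem _ using 1
          ext j <;> fin_cases j <;> simp_all
        · refine AddSubgroup.subset_closure ?_
          rw [Set.mem_singleton_iff]
          ext j <;> fin_cases j <;> simp_all
      · rintro _ rfl
        simp [mem_halfTwistSpace]
    rw [this]
    refine motionGroup_closure_le (fun j => ?_) ?_
    · rw [← unitTranslation_eq]
      exact Subgroup.subset_closure (Or.inl ⟨j, rfl⟩)
    · rintro _ rfl
      refine Subgroup.subset_closure (Or.inr (Eq.symm (signedIsometry_eq_motion ?_ ?_)))
      · intro j; fin_cases j <;> rfl
      · intro j; fin_cases j <;> simp [ZMod.val_one]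

theorem hantzscheWendtGroup_eq :
    hantzscheWendtGroup = motionGroup (1 / 2) hantzscheWendtSpace := by
  refine le_antisymm ?_ ?_
  · refine (Subgroup.closure_le _).2 ?_
    rintro _ (⟨j, rfl⟩ | rfl | rfl | rfl)
    · exact unitTranslation_mem_motionGroup _ j
    · refine ⟨![0, 1, 1], ![1, 1, 0], ?_, signedIsometry_eq_motion ?_ ?_⟩
      · rw [mem_hantzscheWendtSpace]; simpa using (by decide : (1 + 1 : ZMod 2) = 0)
      · intro j; fin_cases j <;> rfl
      · intro j; fin_cases j <;> simp
    · refine ⟨![1, 0, 1], ![0, 1, 1], ?_, signedIsometry_eq_motion ?_ ?_⟩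
      · rw [mem_hantzscheWendtSpace]; simpa using (by decide : (1 + 1 : ZMod 2) = 0)
      · intro j; fin_cases j <;> rfl
      · intro j; fin_cases j <;> simp
    · refine ⟨![1, 1, 0], ![1, 0, 1], ?_, signedIsometry_eq_motion ?_ ?_⟩
      · rw [mem_hantzscheWendtSpace]; simpa using (by decide : (1 + 1 : ZMod 2) = 0)
      · intro j; fin_cases j <;> rfl
      · intro j; fin_cases j <;> simp
  · have : hantzscheWendtSpace ≤ AddSubgroup.closure
        {(![0, 1, 1], ![1, 1, 0]), (![1, 0, 1], ![0, 1, 1]), (![1, 1, 0], ![1, 0, 1])} := by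
      rintro ⟨a, w⟩ ⟨h0, h1, h2, h3⟩
      have h2' : a 2 = a 0 + a 1 := by
        linear_combination h0 - CharTwo.add_self_eq_zero (a 0) - CharTwo.add_self_eq_zero (a 1)
      rcases zmod_two_cases (a 0) with h | h <;> rcases zmod_two_cases (a 1) with h' | h'
      · convert AddSubgroup.zero_mem _ using 1
        ext j <;> fin_cases j <;> simp_all
      all_goals
        refine AddSubgroup.subset_closure ?_
        rw [Set.mem_insert_iff, Set.mem_insert_iff, Set.mem_singleton_iff]
      · refine Or.inl ?_
        ext j <;> fin_cases j <;> simp_all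
      · refine Or.inr (Or.inl ?_)
        ext j <;> fin_cases j <;> simp_all
      · refine Or.inr (Or.inr ?_)
        have h11 : (1 + 1 : ZMod 2) = 0 := by decide
        ext j <;> fin_cases j <;> simp_all
    intro g hg
    obtain ⟨a, w, h, rfl⟩ := hg
    refine motionGroup_closure_le (fun j => ?_) ?_ ⟨a, w, this h, rfl⟩
    · rw [← unitTranslation_eq]
      exact Subgroup.subset_closure (Or.inl ⟨j, rfl⟩)
    · rintro _ (rfl | rfl | rfl)
      · refine Subgroup.subset_closure (Or.inr (Or.inl (Eq.symm (signedIsometry_eq_motion ?_ ?_))))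
        · intro j; fin_cases j <;> rfl
        · intro j; fin_cases j <;> simp [ZMod.val_one]
      · refine Subgroup.subset_closure
          (Or.inr (Or.inr (Or.inl (Eq.symm (signedIsometry_eq_motion ?_ ?_)))))
        · intro j; fin_cases j <;> rfl
        · intro j; fin_cases j <;> simp [ZMod.val_one]
      · refine Subgroup.subset_closure
          (Or.inr (Or.inr (Or.inr (Eq.symm (signedIsometry_eq_motion ?_ ?_)))))
        · intro j; fin_cases j <;> rfl
        · intro j; fin_cases j <;> simp [ZMod.val_one]

/-! ### Orientability -/

theorem continuous_orbitProj (G : Subgroup (E3 ≃ᵢ E3)) : Continuous (orbitProj G) :=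
  continuous_quotient_mk'

/-- The linear part of a signed isometry. -/
noncomputable def signedLinear (s : Fin 3 → ℤˣ) : E3 →L[ℝ] E3 :=
  LinearMap.toContinuousLinearMap
    (Matrix.toLin (EuclideanSpace.basisFun (Fin 3) ℝ).toBasis
      (EuclideanSpace.basisFun (Fin 3) ℝ).toBasis (Matrix.diagonal fun j => ((s j : ℤ) : ℝ)))

theorem signedLinear_det (s : Fin 3 → ℤˣ) : (signedLinear s).det = ∏ j, ((s j : ℤ) : ℝ) := by
  simp [signedLinear, ContinuousLinearMap.det, LinearMap.det_toLin]

theorem signedLinear_apply (s : Fin 3 → ℤˣ) (x : E3) (j : Fin 3) :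
    signedLinear s x j = ((s j : ℤ) : ℝ) * x j := by
  simp [signedLinear, Matrix.toLin_apply, Matrix.mulVec_diagonal, Pi.single_apply]

theorem hasFDerivAt_signedIsometry (s : Fin 3 → ℤˣ) (v : Fin 3 → ℝ) (x : E3) :
    HasFDerivAt (signedIsometry s v) (signedLinear s) x := by
  have : (signedIsometry s v : E3 → E3) = fun x => signedLinear s x + WithLp.toLp 2 v := by
    funext x
    ext j
    simp [signedIsometry, signedLinear_apply]
  rw [this]
  exact (signedLinear s).hasFDerivAt.add_const _

/-- A group with orientable quotient contains no orientation-reversing signed isometry: in an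
oriented atlas the sign of the Jacobian determinant of a chart composed with the projection is a
continuous function on the connected space `ℝ³`, and is reversed by such an isometry. -/
theorem prod_eq_one_of_isOrientable {G : Subgroup (E3 ≃ᵢ E3)} (hG : IsOrientable G)
    {s : Fin 3 → ℤˣ} {v : Fin 3 → ℝ} (hs : signedIsometry s v ∈ G) : ∏ j, s j = 1 := by
  obtain ⟨A, hcov, hsm, hpos⟩ := hG
  have hopen : ∀ φ ∈ A, IsOpen (orbitProj G ⁻¹' φ.source) := fun φ _ =>
    φ.open_source.preimage (continuous_orbitProj G)
  have hdiff : ∀ φ ∈ A, ∀ x ∈ orbitProj G ⁻¹' φ.source,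
      DifferentiableAt ℝ (φ ∘ orbitProj G) x := fun φ hφ x hx =>
    ((hsm φ hφ).1.differentiableOn (by simp)).differentiableAt ((hopen φ hφ).mem_nhds hx)
  have hcont : ∀ φ ∈ A, ContinuousOn (fun x => (fderiv ℝ (φ ∘ orbitProj G) x).det)
      (orbitProj G ⁻¹' φ.source) := fun φ hφ =>
    ContinuousLinearMap.continuous_det.comp_continuousOn
      ((hsm φ hφ).1.continuousOn_fderiv_of_isOpen (hopen φ hφ) (by simp))
  -- The sign does not depend on the chart.
  have hind : ∀ φ ∈ A, ∀ ψ ∈ A, ∀ x, orbitProj G x ∈ φ.source → orbitProj G x ∈ ψ.source →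
      0 < (fderiv ℝ (φ ∘ orbitProj G) x).det → 0 < (fderiv ℝ (ψ ∘ orbitProj G) x).det := by
    intro φ hφ ψ hψ x hx hx' h
    have hy : φ (orbitProj G x) ∈ (φ.symm.trans ψ).source := by
      simp [hx, hx']
    have hp := hpos φ hφ ψ hψ _ hy
    -- A transition map with nonzero `fderiv` determinant is differentiable.
    have hd : DifferentiableAt ℝ (φ.symm.trans ψ) (φ (orbitProj G x)) := by
      by_contra hn
      rw [fderiv_zero_of_not_differentiableAt hn] at hp
      simp [ContinuousLinearMap.det] at hp
    have hev : ψ ∘ orbitProj G =ᶠ[nhds x] (φ.symm.trans ψ) ∘ (φ ∘ orbitProj G) := by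
      filter_upwards [(hopen φ hφ).mem_nhds hx] with z hz
      simp [φ.left_inv hz]
    rw [hev.fderiv_eq, fderiv_comp x hd (hdiff φ hφ x hx)]
    have : ∀ f g : E3 →L[ℝ] E3, (f.comp g).det = f.det * g.det := fun f g => by
      simp [ContinuousLinearMap.det, LinearMap.det_comp]
    rw [this]
    exact mul_pos hp h
  let U : Set E3 := {x | ∃ φ ∈ A, orbitProj G x ∈ φ.source ∧
    0 < (fderiv ℝ (φ ∘ orbitProj G) x).det}
  let V : Set E3 := {x | ∃ φ ∈ A, orbitProj G x ∈ φ.source ∧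
    (fderiv ℝ (φ ∘ orbitProj G) x).det < 0}
  have hU : IsOpen U := by
    refine isOpen_iff_mem_nhds.2 ?_
    rintro x ⟨φ, hφ, hx, h⟩
    have hx' := (hopen φ hφ).mem_nhds hx
    filter_upwards [hx', ((hcont φ hφ).continuousAt hx').eventually (lt_mem_nhds h)] with z hz hz'
    exact ⟨φ, hφ, hz, hz'⟩
  have hV : IsOpen V := by
    refine isOpen_iff_mem_nhds.2 ?_
    rintro x ⟨φ, hφ, hx, h⟩
    have hx' := (hopen φ hφ).mem_nhds hx
    filter_upwards [hx', ((hcont φ hφ).continuousAt hx').eventually (gt_mem_nhds h)] with z hz hz'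
    exact ⟨φ, hφ, hz, hz'⟩
  have hUV : Disjoint U V := by
    rw [Set.disjoint_left]
    rintro x ⟨φ, hφ, hx, h⟩ ⟨ψ, hψ, hx', h'⟩
    exact lt_asymm h' (hind φ hφ ψ hψ x hx hx' h)
  have hcover : (Set.univ : Set E3) ⊆ U ∪ V := by
    intro x _
    obtain ⟨φ, hφ, hx⟩ := hcov (orbitProj G x)
    rcases lt_or_gt_of_ne ((hsm φ hφ).2 x hx) with h | h
    · exact Or.inr ⟨φ, hφ, hx, h⟩
    · exact Or.inl ⟨φ, hφ, hx, h⟩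
  by_contra hne
  have hprod : ∏ j, ((s j : ℤ) : ℝ) = -1 := by
    have := (Int.units_eq_one_or (∏ j, s j)).resolve_left hne
    have h2 := congrArg (fun u : ℤˣ => ((u : ℤ) : ℝ)) this
    simpa using h2
  -- The isometry multiplies the Jacobian determinants by `-1`.
  have hflip : ∀ φ ∈ A, ∀ x, orbitProj G x ∈ φ.source →
      orbitProj G (signedIsometry s v x) ∈ φ.source ∧
      (fderiv ℝ (φ ∘ orbitProj G) (signedIsometry s v x)).det =
        -(fderiv ℝ (φ ∘ orbitProj G) x).det := by
    intro φ hφ x hx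
    have hinv : ∀ z, orbitProj G (signedIsometry s v z) = orbitProj G z := fun z =>
      (Quotient.sound (⟨_, hs, rfl⟩ : orbitSetoid G z (signedIsometry s v z))).symm
    have hx' : orbitProj G (signedIsometry s v x) ∈ φ.source := by rwa [hinv]
    refine ⟨hx', ?_⟩
    have heq : φ ∘ orbitProj G = (φ ∘ orbitProj G) ∘ signedIsometry s v := by
      funext z
      simp [hinv]
    have h1 : fderiv ℝ (φ ∘ orbitProj G) x =
        (fderiv ℝ (φ ∘ orbitProj G) (signedIsometry s v x)).comp (signedLinear s) := by
      conv_lhs => rw [heq]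
      exact ((hdiff φ hφ _ hx').hasFDerivAt.comp x (hasFDerivAt_signedIsometry s v x)).fderiv
    have h2 : (fderiv ℝ (φ ∘ orbitProj G) x).det =
        (fderiv ℝ (φ ∘ orbitProj G) (signedIsometry s v x)).det * (signedLinear s).det := by
      rw [h1]
      simp [ContinuousLinearMap.det, LinearMap.det_comp]
    rw [h2, signedLinear_det, hprod]
    ring
  rcases isPreconnected_univ.subset_or_subset hU hV hUV hcover with h | h
  · obtain ⟨φ, hφ, hx, h0⟩ := h (Set.mem_univ 0)
    obtain ⟨hx', he⟩ := hflip φ hφ 0 hx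
    exact Set.disjoint_left.1 hUV (h (Set.mem_univ _)) ⟨φ, hφ, hx', by linarith⟩
  · obtain ⟨φ, hφ, hx, h0⟩ := h (Set.mem_univ 0)
    obtain ⟨hx', he⟩ := hflip φ hφ 0 hx
    exact Set.disjoint_left.1 hUV ⟨φ, hφ, hx', by linarith⟩ (h (Set.mem_univ _))

/-! ### The kernel of a colouring as a group of motions -/

/-- The facet of the cube in the plane `xⱼ = 0`. -/
def lo : Fin 3 → Fin 6 := ![0, 2, 4]

/-- The facet of the cube in the plane `xⱼ = 1`. -/
def hi : Fin 3 → Fin 6 := ![1, 3, 5]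

theorem axis_lo (j : Fin 3) : axis (lo j) = j := by fin_cases j <;> rfl

theorem axis_hi (j : Fin 3) : axis (hi j) = j := by fin_cases j <;> rfl

theorem level_lo (j : Fin 3) : level (lo j) = 0 := by fin_cases j <;> rfl

theorem level_hi (j : Fin 3) : level (hi j) = 1 := by fin_cases j <;> rfl

theorem facet_cases (i : Fin 6) : (∃ j, i = lo j) ∨ ∃ j, i = hi j := by
  revert i; decide

/-- The pairing of a vector `v ∈ 𝔽₂⁶` with the class of the motion with signs `(-1) ^ a` and
translation vector `2 w`: this motion is a product of reflections, in which the facet `xⱼ = 0`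
occurs `wⱼ + aⱼ` times and the facet `xⱼ = 1` occurs `wⱼ` times, modulo `2`. -/
noncomputable def pairing : (Fin 6 → ZMod 2) →ₗ[ZMod 2]
    ((Fin 3 → ZMod 2) × (Fin 3 → ZMod 2)) →ₗ[ZMod 2] ZMod 2 :=
  LinearMap.mk₂ (ZMod 2)
    (fun v p => ∑ j, (p.2 j * (v (lo j) + v (hi j)) + p.1 j * v (lo j)))
    (fun u v p => by
      rw [← Finset.sum_add_distrib]
      exact Finset.sum_congr rfl fun j _ => by simp only [Pi.add_apply]; ring)
    (fun a v p => by
      rw [Finset.smul_sum]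
      exact Finset.sum_congr rfl fun j _ => by simp only [Pi.smul_apply, smul_eq_mul]; ring)
    (fun v p q => by
      rw [← Finset.sum_add_distrib]
      exact Finset.sum_congr rfl fun j _ => by
        simp only [Prod.fst_add, Prod.snd_add, Pi.add_apply]; ring)
    (fun a v p => by
      rw [Finset.smul_sum]
      exact Finset.sum_congr rfl fun j _ => by
        simp only [Prod.smul_fst, Prod.smul_snd, Pi.smul_apply, smul_eq_mul]; ring)

theorem pairing_apply (v : Fin 6 → ZMod 2) (p : (Fin 3 → ZMod 2) × (Fin 3 → ZMod 2)) :
    pairing v p = ∑ j, (p.2 j * (v (lo j) + v (hi j)) + p.1 j * v (lo j)) := rfl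

variable {k : ℕ}

/-- The colour of the motion with signs `(-1) ^ a` and translation vector `2 w`. -/
noncomputable def motionColour (c : Fin 6 → Fin k → ZMod 2) :
    ((Fin 3 → ZMod 2) × (Fin 3 → ZMod 2)) →+ (Fin k → ZMod 2) :=
  AddMonoidHom.mk' (fun p l => pairing (fun i => c i l) p) fun p q => by
    funext l
    simp

theorem motionColour_apply (c : Fin 6 → Fin k → ZMod 2)
    (p : (Fin 3 → ZMod 2) × (Fin 3 → ZMod 2)) (l : Fin k) :
    motionColour c p l = ∑ j, (p.2 j * (c (lo j) l + c (hi j) l) + p.1 j * c (lo j) l) := rfl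

theorem motionColour_single_zero (c : Fin 6 → Fin k → ZMod 2) (j : Fin 3) :
    motionColour c (Pi.single j 1, 0) = c (lo j) := by
  funext l
  rw [motionColour_apply, Finset.sum_eq_single j]
  · simp
  · intro i _ h
    simp [h]
  · simp

theorem motionColour_single_single (c : Fin 6 → Fin k → ZMod 2) (j : Fin 3) :
    motionColour c (Pi.single j 1, Pi.single j 1) = c (hi j) := by
  funext l
  rw [motionColour_apply, Finset.sum_eq_single j]
  · simp only [Pi.single_eq_same, one_mul]
    linear_combination CharTwo.add_self_eq_zero (c (lo j) l)
  · intro i _ h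
    simp [h]
  · simp

theorem facetReflection_lo (j : Fin 3) : facetReflection (lo j) = motion (Pi.single j 1) 0 := by
  refine signedIsometry_eq_motion (fun i => ?_) fun i => ?_
  · rw [axis_lo]
    rcases eq_or_ne i j with rfl | h
    · simp [sgn_one]
    · simp [h, sgn_zero]
  · rw [axis_lo, level_lo]
    simp

theorem facetReflection_hi (j : Fin 3) :
    facetReflection (hi j) = motion (Pi.single j 1) (Pi.single j 2) := by
  refine signedIsometry_eq_motion (fun i => ?_) fun i => ?_
  · rw [axis_hi]
    rcases eq_or_ne i j with rfl | h
    · simp [sgn_one]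
    · simp [h, sgn_zero]
  · rw [axis_hi, level_hi]
    simp

/-- The element `g` of the Coxeter group acts as the motion with signs `(-1) ^ a` and translation
vector `2 w`, and the colouring sends it to the colour of this motion. -/
def HasData (c : Fin 6 → Fin k → ZMod 2) (g : CoxeterGroup) (a : Fin 3 → ZMod 2)
    (w : Fin 3 → ℤ) : Prop :=
  reflectionAction g = motion a (fun j => 2 * w j) ∧
    colouringHom c g = Multiplicative.ofAdd (motionColour c (a, fun j => (w j : ZMod 2)))

theorem HasData.mul {c : Fin 6 → Fin k → ZMod 2} {g h : CoxeterGroup} {a b : Fin 3 → ZMod 2}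
    {w u : Fin 3 → ℤ} (hg : HasData c g a w) (hh : HasData c h b u) :
    HasData c (g * h) (a + b) fun j => w j + sgn (a j) * u j := by
  refine ⟨?_, ?_⟩
  · rw [map_mul, hg.1, hh.1, motion_mul]
    congr 1
    funext j
    push_cast
    ring
  · rw [map_mul, hg.2, hh.2, ← ofAdd_add, ← map_add, Prod.mk_add_mk]
    congr 3
    funext j
    simp only [Int.cast_add, cast_sgn_mul, Pi.add_apply]

theorem HasData.inv {c : Fin 6 → Fin k → ZMod 2} {g : CoxeterGroup} {a : Fin 3 → ZMod 2}
    {w : Fin 3 → ℤ} (hg : HasData c g a w) :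
    HasData c g⁻¹ a fun j => -(sgn (a j) * w j) := by
  refine ⟨?_, ?_⟩
  · rw [map_inv, hg.1, motion_inv]
    congr 1
    funext j
    push_cast
    ring
  · rw [map_inv, hg.2, ← ofAdd_neg]
    congr 1
    rw [show (fun j => ((-(sgn (a j) * w j) : ℤ) : ZMod 2)) = fun j => (w j : ZMod 2) from
      funext fun j => by rw [Int.cast_neg, cast_sgn_mul, CharTwo.neg_eq]]
    exact funext fun l => CharTwo.neg_eq _

theorem hasData_one (c : Fin 6 → Fin k → ZMod 2) : HasData c 1 0 0 := by
  refine ⟨?_, ?_⟩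
  · rw [map_one, ← motion_zero]
    congr 1
    funext j
    simp
  · rw [map_one, show ((0 : Fin 3 → ZMod 2), fun j => (((0 : Fin 3 → ℤ) j : ℤ) : ZMod 2)) = 0 from
      Prod.ext rfl (funext fun j => by simp), map_zero, ofAdd_zero]

theorem hasData_lo (c : Fin 6 → Fin k → ZMod 2) (j : Fin 3) :
    HasData c (cubeMatrix.toCoxeterSystem.simple (lo j)) (Pi.single j 1) 0 := by
  refine ⟨?_, ?_⟩
  · rw [reflectionAction, CoxeterSystem.lift_apply_simple, facetReflection_lo]
    congr 1
    funext j
    simp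
  · rw [colouringHom, CoxeterSystem.lift_apply_simple, ← motionColour_single_zero c j]
    simp only [Pi.zero_apply, Int.cast_zero]
    rfl

theorem hasData_hi (c : Fin 6 → Fin k → ZMod 2) (j : Fin 3) :
    HasData c (cubeMatrix.toCoxeterSystem.simple (hi j)) (Pi.single j 1) (Pi.single j 1) := by
  refine ⟨?_, ?_⟩
  · rw [reflectionAction, CoxeterSystem.lift_apply_simple, facetReflection_hi]
    congr 1
    funext i
    rcases eq_or_ne i j with rfl | h
    · simp
    · simp [h]
  · rw [colouringHom, CoxeterSystem.lift_apply_simple, ← motionColour_single_single c j]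
    congr 3
    funext i
    rcases eq_or_ne i j with rfl | h
    · simp
    · simp [h]

theorem exists_hasData (c : Fin 6 → Fin k → ZMod 2) (g : CoxeterGroup) :
    ∃ a w, HasData c g a w := by
  refine cubeMatrix.toCoxeterSystem.simple_induction_left (p := fun g => ∃ a w, HasData c g a w) g
    ⟨_, _, hasData_one c⟩ ?_
  rintro g i ⟨a, w, h⟩
  rcases facet_cases i with ⟨j, rfl⟩ | ⟨j, rfl⟩
  · exact ⟨_, _, (hasData_lo c j).mul h⟩
  · exact ⟨_, _, (hasData_hi c j).mul h⟩

theorem exists_hasData_zero_left (c : Fin 6 → Fin k → ZMod 2) (w : Fin 3 → ℤ) :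
    ∃ g, HasData c g 0 w := by
  let P : AddSubgroup (Fin 3 → ℤ) :=
    { carrier := {w | ∃ g, HasData c g 0 w}
      zero_mem' := ⟨1, hasData_one c⟩
      add_mem' := by
        rintro w u ⟨g, hg⟩ ⟨h, hh⟩
        refine ⟨g * h, ?_⟩
        convert hg.mul hh using 1
        · simp
        · funext j
          simp [sgn_zero]
      neg_mem' := by
        rintro w ⟨g, hg⟩
        refine ⟨g⁻¹, ?_⟩
        convert hg.inv using 1
        funext j
        simp [sgn_zero] }
  suffices w ∈ P from this
  refine AddSubgroup.pi_mem_of_single_mem w fun j => ?_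
  have h1 : Pi.single j 1 ∈ P := by
    refine ⟨cubeMatrix.toCoxeterSystem.simple (hi j) * cubeMatrix.toCoxeterSystem.simple (lo j), ?_⟩
    convert (hasData_hi c j).mul (hasData_lo c j) using 1
    · exact funext fun i => (CharTwo.add_self_eq_zero _).symm
    · funext i
      simp
  have := P.zsmul_mem h1 (w j)
  rwa [← Pi.single_smul, smul_eq_mul, mul_one] at this

theorem exists_hasData_zero_right (c : Fin 6 → Fin k → ZMod 2) (a : Fin 3 → ZMod 2) :
    ∃ g, HasData c g a 0 := by
  let P : AddSubgroup (Fin 3 → ZMod 2) :=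
    { carrier := {a | ∃ g, HasData c g a 0}
      zero_mem' := ⟨1, hasData_one c⟩
      add_mem' := by
        rintro a b ⟨g, hg⟩ ⟨h, hh⟩
        refine ⟨g * h, ?_⟩
        convert hg.mul hh using 1
        funext j
        simp
      neg_mem' := by
        rintro a ⟨g, hg⟩
        refine ⟨g⁻¹, ?_⟩
        convert hg.inv using 1
        · exact funext fun j => CharTwo.neg_eq _
        · funext j
          simp }
  suffices a ∈ P from this
  refine AddSubgroup.pi_mem_of_single_mem a fun j => ?_
  rcases zmod_two_cases (a j) with h | h <;> rw [h]
  · rw [Pi.single_zero]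
    exact P.zero_mem
  · exact ⟨_, hasData_lo c j⟩

theorem exists_group_hasData (c : Fin 6 → Fin k → ZMod 2) (a : Fin 3 → ZMod 2) (w : Fin 3 → ℤ) :
    ∃ g, HasData c g a w := by
  obtain ⟨g, hg⟩ := exists_hasData_zero_left c w
  obtain ⟨h, hh⟩ := exists_hasData_zero_right c a
  refine ⟨g * h, ?_⟩
  convert hg.mul hh using 1
  · simp
  · funext j
    simp

theorem kernelGroup_eq (c : Fin 6 → Fin k → ZMod 2) :
    kernelGroup c = motionGroup 2 (motionColour c).ker := by
  ext f
  constructor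
  · rintro ⟨g, hg, rfl⟩
    obtain ⟨a, w, h⟩ := exists_hasData c g
    refine ⟨a, w, ?_, h.1⟩
    have h2 := h.2
    rw [show colouringHom c g = 1 from hg] at h2
    exact h2.symm
  · rintro ⟨a, w, h, rfl⟩
    obtain ⟨g, hg⟩ := exists_group_hasData c a w
    refine ⟨g, ?_, hg.1⟩
    change colouringHom c g = 1
    rw [hg.2, AddMonoidHom.mem_ker.1 h, ofAdd_zero]

/-! ### Consequences of the hypotheses on the colouring -/

theorem sum_eq_zero_of_isOrientable {c : Fin 6 → Fin k → ZMod 2}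
    (hc : IsOrientable (kernelGroup c)) {p : (Fin 3 → ZMod 2) × (Fin 3 → ZMod 2)}
    (hp : p ∈ (motionColour c).ker) : p.1 0 + p.1 1 + p.1 2 = 0 := by
  have h : motion p.1 (fun j => 2 * (((p.2 j).val : ℤ) : ℝ)) ∈ kernelGroup c := by
    rw [kernelGroup_eq]
    refine ⟨p.1, fun j => (p.2 j).val, ?_, rfl⟩
    simpa using hp
  have h2 := prod_eq_one_of_isOrientable hc h
  rw [Fin.prod_univ_three] at h2
  have key : ∀ a b d : ZMod 2, sgn a * sgn b * sgn d = 1 → a + b + d = 0 := by decide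
  exact key _ _ _ h2

/-- In a nonzero relation between the colours of a proper colouring, some pair of parallel facets
occurs with both coefficients equal to `1`. -/
theorem IsProper.exists_eq_zero_and_eq_one {c : Fin 6 → Fin k → ZMod 2} (hc : IsProper c)
    {p : (Fin 3 → ZMod 2) × (Fin 3 → ZMod 2)} (hp : p ∈ (motionColour c).ker) (h0 : p ≠ 0) :
    ∃ j, p.1 j = 0 ∧ p.2 j = 1 := by
  by_contra hno
  have hw : ∀ j, p.1 j = 0 → p.2 j = 0 := fun j hj =>
    (zmod_two_cases _).resolve_right fun h => hno ⟨j, hj, h⟩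
  -- The facets through one vertex which carry the relation.
  let f : Fin 3 → Fin 6 := fun j => if p.2 j = 0 then lo j else hi j
  have haxis : ∀ j, axis (f j) = j := fun j => by
    simp only [f]
    split_ifs
    · exact axis_lo j
    · exact axis_hi j
  have hlevel : ∀ i, level i ∈ Set.Icc (0 : ℝ) 1 := fun i => by
    rcases facet_cases i with ⟨j, rfl⟩ | ⟨j, rfl⟩
    · simp [level_lo]
    · simp [level_hi]
  have hli := hc (Finset.univ.image f) ⟨WithLp.toLp 2 fun j => level (f j), by
    simp only [Set.mem_iInter, Finset.mem_image, Finset.mem_univ, true_and]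
    rintro _ ⟨j, rfl⟩
    exact ⟨fun j => hlevel _, by simp [haxis]⟩⟩
  have hli' : LinearIndependent (ZMod 2) fun j => c (f j) :=
    hli.comp (fun j => ⟨f j, Finset.mem_image_of_mem f (Finset.mem_univ j)⟩) fun i j hij => by
      have := congrArg (fun t => axis t.1) hij
      simpa [haxis] using this
  have hsum : ∑ j, p.1 j • c (f j) = 0 := by
    rw [← AddMonoidHom.mem_ker.1 hp]
    funext l
    rw [motionColour_apply, Finset.sum_apply]
    refine Finset.sum_congr rfl fun j _ => ?_
    rw [Pi.smul_apply, smul_eq_mul]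
    rcases zmod_two_cases (p.1 j) with h | h
    · simp [h, hw j h]
    · rcases zmod_two_cases (p.2 j) with h' | h'
      · simp [f, h, h']
      · simp only [f, h, h', one_ne_zero, if_false, one_mul]
        linear_combination -CharTwo.add_self_eq_zero (c (lo j) l)
  have ha := Fintype.linearIndependent_iff.1 hli' p.1 hsum
  exact h0 (Prod.ext (funext ha) (funext fun j => hw j (ha j)))

theorem pairing_injective : Function.Injective pairing := by
  rw [injective_iff_map_eq_zero]
  intro v hv
  have hlo : ∀ j, v (lo j) = 0 := fun j => by
    have h := LinearMap.congr_fun hv (Pi.single j 1, 0)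
    rw [pairing_apply, Finset.sum_eq_single j (fun i _ h => by simp [h]) (by simp)] at h
    simpa using h
  have hhi : ∀ j, v (hi j) = 0 := fun j => by
    have h := LinearMap.congr_fun hv (0, Pi.single j 1)
    rw [pairing_apply, Finset.sum_eq_single j (fun i _ h => by simp [h]) (by simp)] at h
    simpa [hlo] using h
  funext i
  rcases facet_cases i with ⟨j, rfl⟩ | ⟨j, rfl⟩
  · exact hlo j
  · exact hhi j

theorem pairing_e_add_e (j : Fin 3) (p : (Fin 3 → ZMod 2) × (Fin 3 → ZMod 2)) :
    pairing (e (lo j) + e (hi j)) p = p.1 j := by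
  have h2 : ∀ a b : ZMod 2, a + b + a = b := by decide
  fin_cases j <;> simp [pairing_apply, Fin.sum_univ_three, e, lo, hi, Pi.single_apply, h2]

/-- The row space is the annihilator of the relations between the colours. -/
theorem mem_rowSpace_iff (c : Fin 6 → Fin k → ZMod 2) (v : Fin 6 → ZMod 2) :
    v ∈ rowSpace (definingMatrix c) ↔ ∀ p ∈ (motionColour c).ker, pairing v p = 0 := by
  constructor
  · intro hv p hp
    induction hv using Submodule.span_induction with
    | mem v hv =>
      obtain ⟨l, rfl⟩ := hv
      exact congrFun hp l
    | zero => simp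
    | add u v _ _ hu hv => simp [hu, hv]
    | smul a v _ hv => simp [hv]
  · intro h
    have key : pairing v ∈ Submodule.span (ZMod 2)
        (Set.range fun l => pairing ((definingMatrix c).row l)) := by
      refine mem_span_of_iInf_ker_le_ker fun p hp => h p ?_
      rw [Submodule.mem_iInf] at hp
      exact funext fun l => hp l
    rw [show (Set.range fun l => pairing ((definingMatrix c).row l)) =
      pairing '' Set.range (definingMatrix c).row from Set.range_comp pairing _,
      ← Submodule.map_span] at key
    obtain ⟨u, hu, huv⟩ := key
    rwa [← pairing_injective huv]

theorem e_add_e_mem_rowSpace_iff (c : Fin 6 → Fin k → ZMod 2) (j : Fin 3) :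
    e (lo j) + e (hi j) ∈ rowSpace (definingMatrix c) ↔
      ∀ p ∈ (motionColour c).ker, p.1 j = 0 := by
  simp only [mem_rowSpace_iff, pairing_e_add_e]

theorem mem_T_iff (v : Fin 6 → ZMod 2) : v ∈ T ↔ ∃ j, v = e (lo j) + e (hi j) := by
  constructor
  · rintro (rfl | rfl | rfl)
    exacts [⟨0, rfl⟩, ⟨1, rfl⟩, ⟨2, rfl⟩]
  · rintro ⟨j, rfl⟩
    fin_cases j
    exacts [Or.inl rfl, Or.inr (Or.inl rfl), Or.inr (Or.inr rfl)]

/-! ### Homeomorphisms of orbit spaces -/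

theorem nonempty_orbitSpace_homeomorph {G H : Subgroup (E3 ≃ᵢ E3)} (h : E3 ≃ₜ E3)
    (hGH : ∀ x y, (∃ g ∈ G, g x = y) ↔ ∃ g ∈ H, g (h x) = h y) :
    Nonempty (OrbitSpace G ≃ₜ OrbitSpace H) :=
  ⟨{ Quotient.congr h.toEquiv hGH with
    continuous_toFun := continuous_quot_lift _ (continuous_quotient_mk'.comp h.continuous)
    continuous_invFun :=
      continuous_quot_lift _ (continuous_quotient_mk'.comp h.symm.continuous) }⟩

/-- The lattice of the vectors `w / 2`, where `w` is an integral vector whose class modulo `2` lies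
in a prescribed subgroup, is mapped onto the integral vectors by some linear automorphism. -/
theorem exists_lattice_equiv {n : ℕ} (K : AddSubgroup (Fin n → ZMod 2)) :
    ∃ A : (Fin n → ℝ) ≃L[ℝ] (Fin n → ℝ), ∀ v,
      (∃ m : Fin n → ℤ, ∀ i, A v i = m i) ↔
        ∃ w : Fin n → ℤ, (fun i => (w i : ZMod 2)) ∈ K ∧ ∀ i, v i = w i / 2 := by
  -- The lattice before halving. It lies between `2 ℤⁿ` and `ℤⁿ`, hence is discrete and spans.
  let L₀ : AddSubgroup (Fin n → ℤ) :=
    K.comap ((Int.castAddHom (ZMod 2)).compLeft (Fin n))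
  let L : Submodule ℤ (Fin n → ℝ) :=
    AddSubgroup.toIntSubmodule (L₀.map ((Int.castAddHom ℝ).compLeft (Fin n)))
  have hL : ∀ v, v ∈ L ↔ ∃ w : Fin n → ℤ, (fun i => (w i : ZMod 2)) ∈ K ∧ ∀ i, v i = w i := by
    intro v
    constructor
    · rintro ⟨w, hw, rfl⟩
      exact ⟨w, hw, fun i => rfl⟩
    · rintro ⟨w, hw, h⟩
      exact ⟨w, hw, funext fun i => (h i).symm⟩
  have hLle : L ≤ Submodule.span ℤ (Set.range (Pi.basisFun ℝ (Fin n))) := by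
    intro v hv
    obtain ⟨w, -, h⟩ := (hL v).1 hv
    rw [Module.Basis.mem_span_iff_repr_mem]
    exact fun i => ⟨w i, by simp [h]⟩
  have hdisc : DiscreteTopology L :=
    DiscreteTopology.of_subset
      (inferInstanceAs (DiscreteTopology (Submodule.span ℤ (Set.range (Pi.basisFun ℝ (Fin n))))))
      hLle
  have hspan : IsZLattice ℝ L := by
    refine ⟨?_⟩
    rw [eq_top_iff, ← (Pi.basisFun ℝ (Fin n)).span_eq, Submodule.span_le]
    rintro _ ⟨j, rfl⟩
    have h2 : (2 : ℝ) • Pi.basisFun ℝ (Fin n) j ∈ L := by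
      refine (hL _).2 ⟨Pi.single j 2, ?_, ?_⟩
      · convert K.zero_mem using 1
        funext i
        rcases eq_or_ne i j with rfl | h
        · rw [Pi.single_eq_same]
          exact (by decide : ((2 : ℤ) : ZMod 2) = 0)
        · simp [h]
      · intro i
        rcases eq_or_ne i j with rfl | h
        · simp
        · simp [h]
    have := Submodule.smul_mem (Submodule.span ℝ (L : Set (Fin n → ℝ))) (2⁻¹ : ℝ)
      (Submodule.subset_span h2)
    rwa [smul_smul, inv_mul_cancel₀ two_ne_zero, one_smul] at this
  have hfree : Module.Free ℤ L := ZLattice.module_free ℝ L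
  have hfin : Module.Finite ℤ L := ZLattice.module_finite ℝ L
  have hrank : Module.finrank ℤ L = n := by
    rw [ZLattice.rank ℝ L, Module.finrank_fin_fun]
  let b : Module.Basis (Fin n) ℤ L := Module.finBasisOfFinrankEq ℤ L hrank
  let B : Module.Basis (Fin n) ℝ (Fin n → ℝ) := b.ofZLatticeBasis ℝ L
  have hB : ∀ v, (∃ m : Fin n → ℤ, ∀ i, B.repr v i = m i) ↔ v ∈ L := by
    intro v
    have := B.mem_span_iff_repr_mem ℤ v
    rw [show Submodule.span ℤ (Set.range B) = L from b.ofZLatticeBasis_span ℝ L] at this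
    rw [this]
    constructor
    · rintro ⟨m, hm⟩ i
      exact ⟨m i, by simp [hm]⟩
    · intro h
      choose m hm using h
      exact ⟨m, fun i => by simpa using (hm i).symm⟩
  refine ⟨((LinearEquiv.smulOfNeZero ℝ (Fin n → ℝ) (2 : ℝ) two_ne_zero).trans
    B.equivFun).toContinuousLinearEquiv, fun v => ?_⟩
  rw [show (∃ m : Fin n → ℤ, ∀ i, (((LinearEquiv.smulOfNeZero ℝ (Fin n → ℝ) (2 : ℝ)
      two_ne_zero).trans B.equivFun).toContinuousLinearEquiv v) i = m i) ↔ (2 : ℝ) • v ∈ L from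
    hB ((2 : ℝ) • v), hL]
  refine exists_congr fun w => and_congr_right fun _ => forall_congr' fun i => ?_
  rw [Pi.smul_apply, smul_eq_mul, eq_div_iff two_ne_zero, mul_comm]

/-- The similarity `x ↦ (x + τ) / 4` of Euclidean space. -/
noncomputable def quarterSimilarity (τ : Fin 3 → ℝ) : E3 ≃ₜ E3 where
  toFun x := WithLp.toLp 2 fun j => (x j + τ j) / 4
  invFun y := WithLp.toLp 2 fun j => 4 * y j - τ j
  left_inv x := by ext j; simp; ring
  right_inv y := by ext j; simp
  continuous_toFun := by fun_prop
  continuous_invFun := by fun_prop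

/-- The affine homeomorphism which sends the `j`-th axis to the first one, with scaling factor
`1 / 4`, and is the composition of `x ↦ (x + τ) / 4` and `A` on the complementary coordinates. -/
noncomputable def axisAffinity (j : Fin 3) (τ : Fin 2 → ℝ)
    (A : (Fin 2 → ℝ) ≃L[ℝ] (Fin 2 → ℝ)) : E3 ≃ₜ E3 where
  toFun x := WithLp.toLp 2 (Fin.cons (x j / 4) (A fun i => (x (j.succAbove i) + τ i) / 4))
  invFun y := WithLp.toLp 2 (j.insertNth (4 * y 0) fun i => 4 * A.symm (fun l => y l.succ) i - τ i)
  left_inv x := by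
    ext l
    refine Fin.succAboveCases j ?_ (fun i => ?_) l
    · simp; ring
    · simp; ring
  right_inv y := by
    ext l
    refine Fin.cases ?_ (fun i => ?_) l
    · simp
    · simp
  continuous_toFun := by
    refine (PiLp.continuous_toLp 2 _).comp (continuous_pi fun l => ?_)
    refine Fin.cases ?_ (fun i => ?_) l
    · simp only [Fin.cons_zero]
      fun_prop
    · simp only [Fin.cons_succ]
      fun_prop
  continuous_invFun := by
    refine (PiLp.continuous_toLp 2 _).comp (continuous_pi fun l => ?_)
    refine Fin.succAboveCases j ?_ (fun i => ?_) l
    · simp only [Fin.insertNth_apply_same]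
      fun_prop
    · simp only [Fin.insertNth_apply_succAbove]
      fun_prop

/-! ### The three cases -/

theorem smul_mem_of_mem {K : AddSubgroup ((Fin 3 → ZMod 2) × (Fin 3 → ZMod 2))}
    {p : (Fin 3 → ZMod 2) × (Fin 3 → ZMod 2)} (hp : p ∈ K) (t : ZMod 2) : t • p ∈ K := by
  rcases zmod_two_cases t with rfl | rfl
  · simp
  · simpa using hp

theorem sgn_eq (a : ZMod 2) : ((sgn a : ℤ) : ℝ) = 1 - 2 * a.val := by
  rcases zmod_two_cases a with rfl | rfl
  · simp [sgn_zero]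
  · norm_num [sgn_one, ZMod.val_one]

/-- If all the motions are translations, the quotient is a torus. -/
theorem nonempty_homeomorph_threeTorus
    {K : AddSubgroup ((Fin 3 → ZMod 2) × (Fin 3 → ZMod 2))} (hK : ∀ p ∈ K, p.1 = 0) :
    Nonempty (OrbitSpace (motionGroup 2 K) ≃ₜ ThreeTorus) := by
  obtain ⟨A, hA⟩ := exists_lattice_equiv
    (K.comap (AddMonoidHom.inr (Fin 3 → ZMod 2) (Fin 3 → ZMod 2)))
  let f : E3 → ThreeTorus := fun x j => ((A (fun i => x i / 4) j : ℝ) : UnitAddCircle)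
  have hf : IsOpenQuotientMap f := by
    have h1 : IsOpenQuotientMap (Pi.map fun (_ : Fin 3) (t : ℝ) => (t : UnitAddCircle)) :=
      IsOpenQuotientMap.piMap fun _ => QuotientAddGroup.isOpenQuotientMap_mk
    have h2 : f = (Pi.map fun (_ : Fin 3) (t : ℝ) => (t : UnitAddCircle)) ∘ A ∘
        EuclideanSpace.equiv (Fin 3) ℝ ∘ quarterSimilarity 0 := by
      funext x j
      have : (EuclideanSpace.equiv (Fin 3) ℝ) (quarterSimilarity 0 x) = fun i => x i / 4 := by
        funext i
        simp [quarterSimilarity]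
      simp only [f, Function.comp_apply, Pi.map_apply, this]
    rw [h2]
    exact h1.comp (A.toHomeomorph.isOpenQuotientMap.comp
      ((EuclideanSpace.equiv (Fin 3) ℝ).toHomeomorph.isOpenQuotientMap.comp
        (quarterSimilarity 0).isOpenQuotientMap))
  have hker : orbitSetoid (motionGroup 2 K) = Setoid.ker f := by
    ext x y
    rw [show (orbitSetoid (motionGroup 2 K)) x y ↔ ∃ g ∈ motionGroup 2 K, g x = y from Iff.rfl,
      exists_motionGroup_apply_eq, Setoid.ker_def, eq_comm, funext_iff]
    have h1 : ∀ j, f y j = f x j ↔ ∃ n : ℤ, A (fun i => (y i - x i) / 4) j = n := by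
      intro j
      have h2 : (fun i => (y i - x i) / 4) = (fun i => y i / 4) - fun i => x i / 4 := by
        funext i
        simp [sub_div]
      rw [h2, map_sub, ← sub_eq_zero, ← AddCircle.coe_sub, AddCircle.coe_eq_zero_iff]
      exact exists_congr fun n => by rw [zsmul_one]; exact eq_comm
    simp only [h1]
    rw [show (∀ j, ∃ n : ℤ, A (fun i => (y i - x i) / 4) j = n) ↔
      ∃ n : Fin 3 → ℤ, ∀ j, A (fun i => (y i - x i) / 4) j = n j from Classical.skolem, hA]
    constructor
    · rintro ⟨a, w, h, hy⟩
      obtain rfl : a = 0 := hK _ h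
      refine ⟨w, h, fun i => ?_⟩
      rw [hy i, Pi.zero_apply, sgn_zero]
      push_cast
      ring
    · rintro ⟨w, h, hw⟩
      refine ⟨0, w, h, fun i => ?_⟩
      have := hw i
      rw [Pi.zero_apply, sgn_zero]
      push_cast
      linarith
  have hq : Topology.IsQuotientMap (ContinuousMap.mk f hf.continuous) := hf.isQuotientMap
  have e := hq.homeomorph
  change Nonempty (Quotient (orbitSetoid (motionGroup 2 K)) ≃ₜ ThreeTorus)
  rw [hker]
  exact ⟨e⟩

/-- If no motion reverses the direction of the `j`-th axis and some motion is not a translation,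
then the translations are a lattice in the complementary plane together with the vector `4 eⱼ`, and
the quotient is the half-twist manifold. -/
theorem nonempty_homeomorph_halfTwistManifold
    {K : AddSubgroup ((Fin 3 → ZMod 2) × (Fin 3 → ZMod 2))}
    (hsum : ∀ p ∈ K, p.1 0 + p.1 1 + p.1 2 = 0)
    (hK : ∀ p ∈ K, p ≠ 0 → ∃ j, p.1 j = 0 ∧ p.2 j = 1)
    {j : Fin 3} (hj : ∀ p ∈ K, p.1 j = 0)
    {u : (Fin 3 → ZMod 2) × (Fin 3 → ZMod 2)} (hu : u ∈ K) (hu0 : u.1 ≠ 0) :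
    Nonempty (OrbitSpace (motionGroup 2 K) ≃ₜ HalfTwistManifold) := by
  have hsum' : ∀ p ∈ K, p.1 (j.succAbove 0) = p.1 (j.succAbove 1) := by
    intro p hp
    have h := hsum p hp
    rw [← Fin.sum_univ_three, Fin.sum_univ_succAbove _ j, Fin.sum_univ_two, hj p hp, zero_add] at h
    exact CharTwo.add_eq_zero.1 h
  have hne : ∀ p ∈ K, p.1 (j.succAbove 0) = 0 → p.1 = 0 := by
    intro p hp h
    funext l
    refine Fin.succAboveCases j (hj p hp) (fun i => ?_) l
    fin_cases i
    · exact h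
    · exact (hsum' p hp).symm.trans h
  have hone : ∀ p ∈ K, p.1 (j.succAbove 0) = 1 → p.2 j = 1 := by
    intro p hp h
    obtain ⟨l, hl, hl'⟩ := hK p hp (by rintro rfl; simp at h)
    obtain rfl | ⟨i, rfl⟩ := Fin.eq_self_or_eq_succAbove j l
    · exact hl'
    · exfalso
      have h' := (hsum' p hp).symm.trans h
      fin_cases i
      · exact zero_ne_one (hl.symm.trans h)
      · exact zero_ne_one (hl.symm.trans h')
  have hu1 : u.1 (j.succAbove 0) = 1 :=
    (zmod_two_cases _).resolve_left fun h => hu0 (hne u hu h)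
  -- Each motion turns the plane by the sign of the parity of its translation along the axis.
  have hpar : ∀ p ∈ K, ∀ i, p.1 (j.succAbove i) = p.2 j := by
    intro p hp i
    have h0 : p.1 (j.succAbove 0) = p.2 j := by
      rcases zmod_two_cases (p.1 (j.succAbove 0)) with h | h
      · have h1 := hone _ (K.add_mem hp hu) (by simp [h, hu1])
        rw [Prod.snd_add, Pi.add_apply, hone u hu hu1] at h1
        rw [h]
        exact (add_eq_right.1 h1).symm
      · rw [h, hone p hp h]
    fin_cases i
    · exact h0
    · exact (hsum' p hp).symm.trans h0
  have huj : u.2 j = 1 := hone u hu hu1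
  -- The translations in the plane complementary to the axis.
  let K₀ : AddSubgroup (Fin 2 → ZMod 2) :=
    { carrier := {v | ∃ p ∈ K, p.2 j = 0 ∧ ∀ i, p.2 (j.succAbove i) = v i}
      zero_mem' := ⟨0, K.zero_mem, rfl, fun i => rfl⟩
      add_mem' := by
        rintro v w ⟨p, hp, h, h'⟩ ⟨q, hq, g, g'⟩
        exact ⟨p + q, K.add_mem hp hq, by simp [h, g], fun i => by simp [h', g']⟩
      neg_mem' := by
        rintro v ⟨p, hp, h, h'⟩
        exact ⟨-p, K.neg_mem hp, by simp [h], fun i => by simp [h']⟩ }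
  obtain ⟨A, hA⟩ := exists_lattice_equiv K₀
  -- The axis of the screw motion given by `u` meets the plane in the point `τ`; the shift by `τ`
  -- used below has the same effect as a shift by `-τ`, since `2 τ - (-2 τ) ∈ 4 ℤ²`.
  let τ : Fin 2 → ℤ := fun i => (u.2 (j.succAbove i)).val
  have hτ : ∀ i, (τ i : ZMod 2) = u.2 (j.succAbove i) := fun i => by simp [τ]
  have horb : ∀ x y : E3, (∃ g ∈ motionGroup 2 K, g x = y) ↔
      ∃ (n : ℤ) (z : Fin 2 → ℤ), (fun i => (z i : ZMod 2)) ∈ K₀ ∧ y j = x j + 2 * n ∧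
        ∀ i, y (j.succAbove i) + τ i =
          ((sgn n : ℤ) : ℝ) * (x (j.succAbove i) + τ i) + 2 * z i := by
    intro x y
    rw [exists_motionGroup_apply_eq]
    constructor
    · rintro ⟨a, w, h, hy⟩
      refine ⟨w j, fun i => w (j.succAbove i) + (w j : ZMod 2).val * τ i,
        ⟨_, K.add_mem h (smul_mem_of_mem hu (w j : ZMod 2)), ?_, fun i => ?_⟩, ?_, fun i => ?_⟩
      · simp [huj, CharTwo.add_self_eq_zero]
      · simp [hτ]
      · rw [hy, show a j = 0 from hj _ h, sgn_zero]
        push_cast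
        ring
      · rw [hy, show a (j.succAbove i) = w j from hpar _ h i, sgn_eq]
        push_cast
        ring
    · rintro ⟨n, z, ⟨p, hp, hpj, hpz⟩, hyj, hy⟩
      let w : Fin 3 → ℤ := j.insertNth n fun i => z i - (n : ZMod 2).val * τ i
      have hw : (p + (n : ZMod 2) • u).2 = fun l => (w l : ZMod 2) := by
        funext l
        refine Fin.succAboveCases j ?_ (fun i => ?_) l
        · simp [w, hpj, huj]
        · simp [w, hpz, hτ, CharTwo.sub_eq_add]
      have hmem : ((p + (n : ZMod 2) • u).1, fun l => (w l : ZMod 2)) ∈ K := by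
        rw [← hw]
        exact K.add_mem hp (smul_mem_of_mem hu _)
      refine ⟨(p + (n : ZMod 2) • u).1, w, hmem, fun l => ?_⟩
      have hwj : w j = n := by simp [w]
      refine Fin.succAboveCases j ?_ (fun i => ?_) l
      · rw [hj _ hmem, hwj, hyj, sgn_zero]
        push_cast
        ring
      · have h1 := hpar _ hmem i
        rw [show (((p + (n : ZMod 2) • u).1, fun l => (w l : ZMod 2)).2 j) = (n : ZMod 2) by
          rw [← hwj]] at h1
        have h2 := hy i
        rw [sgn_eq] at h2
        rw [h1, sgn_eq, show w (j.succAbove i) = z i - (n : ZMod 2).val * τ i by simp [w]]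
        push_cast
        linear_combination h2
  have horb' : ∀ x y : E3, (∃ g ∈ halfTwistGroup, g x = y) ↔
      ∃ (n : ℤ) (m : Fin 2 → ℤ), y 0 = x 0 + n / 2 ∧
        ∀ i : Fin 2, y i.succ = ((sgn n : ℤ) : ℝ) * x i.succ + m i := by
    intro x y
    rw [halfTwistGroup_eq, exists_motionGroup_apply_eq]
    constructor
    · rintro ⟨a, w, ⟨h0, h1, h2, h3, h4⟩, hy⟩
      simp only at h0 h1 h2 h3 h4
      obtain ⟨m₁, h3⟩ := (ZMod.intCast_zmod_eq_zero_iff_dvd (w 1) 2).1 h3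
      obtain ⟨m₂, h4⟩ := (ZMod.intCast_zmod_eq_zero_iff_dvd (w 2) 2).1 h4
      refine ⟨w 0, ![m₁, m₂], ?_, fun i => ?_⟩
      · rw [hy, h0, sgn_zero]
        push_cast
        ring
      · rw [hy]
        fin_cases i
        · simp [h1, h3]
        · simp [h2, h4]
    · rintro ⟨n, m, h0, hy⟩
      refine ⟨![0, n, n], ![n, 2 * m 0, 2 * m 1], ⟨rfl, rfl, rfl, ?_, ?_⟩, fun l => ?_⟩
      · simpa using Or.inl (by decide : (2 : ZMod 2) = 0)
      · simpa using Or.inl (by decide : (2 : ZMod 2) = 0)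
      · refine Fin.cases ?_ (fun i => ?_) l
        · rw [h0]
          simp [sgn_zero]
          ring
        · rw [hy]
          fin_cases i <;> simp
  refine nonempty_orbitSpace_homeomorph (axisAffinity j (fun i => τ i) A) fun x y => ?_
  rw [horb, horb']
  have h0 : ∀ x : E3, axisAffinity j (fun i => τ i) A x 0 = x j / 4 := fun x => rfl
  have hs : ∀ (x : E3) (i : Fin 2), axisAffinity j (fun i => τ i) A x i.succ =
      A (fun i => (x (j.succAbove i) + τ i) / 4) i := fun x i => rfl
  simp only [h0, hs]
  refine exists_congr fun n => ?_
  -- The displacement in the plane which has to be an element of the lattice.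
  have hlat := hA fun i => (y (j.succAbove i) + τ i) / 4 -
    ((sgn n : ℤ) : ℝ) * ((x (j.succAbove i) + τ i) / 4)
  have hlin : A (fun i => (y (j.succAbove i) + τ i) / 4 -
      ((sgn n : ℤ) : ℝ) * ((x (j.succAbove i) + τ i) / 4)) =
      A (fun i => (y (j.succAbove i) + τ i) / 4) -
        ((sgn n : ℤ) : ℝ) • A (fun i => (x (j.succAbove i) + τ i) / 4) := by
    rw [← map_smul, ← map_sub]
    rfl
  rw [hlin] at hlat
  constructor
  · rintro ⟨z, hz, hj', hy⟩
    obtain ⟨m, hm⟩ := hlat.2 ⟨z, hz, fun i => by rw [hy i]; ring⟩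
    refine ⟨m, by rw [hj']; ring, fun i => ?_⟩
    have := hm i
    rw [Pi.sub_apply, Pi.smul_apply, smul_eq_mul] at this
    linarith
  · rintro ⟨m, hj', hm⟩
    obtain ⟨z, hz, hy⟩ := hlat.1 ⟨m, fun i => by
      rw [Pi.sub_apply, Pi.smul_apply, smul_eq_mul, hm i]; ring⟩
    exact ⟨z, hz, by linarith, fun i => by linarith [hy i]⟩

/-- If for each axis some motion reverses its direction, then every motion is determined by its signs
up to translations by `4 ℤ³`, and its translation part is the cyclic shift of the signs up to a
shift of the origin. -/
theorem exists_mem_iff_cyclic_shift {K : AddSubgroup ((Fin 3 → ZMod 2) × (Fin 3 → ZMod 2))}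
    (hsum : ∀ p ∈ K, p.1 0 + p.1 1 + p.1 2 = 0)
    (hK : ∀ p ∈ K, p ≠ 0 → ∃ j, p.1 j = 0 ∧ p.2 j = 1)
    (hT : ∀ j, ∃ p ∈ K, p.1 j ≠ 0) :
    ∃ τ : Fin 3 → ZMod 2, ∀ p, p ∈ K ↔
      p.1 0 + p.1 1 + p.1 2 = 0 ∧ ∀ j, p.2 j = p.1 (j + 1) + τ j * p.1 j := by
  have hsum' : ∀ p ∈ K, ∀ i, p.1 i + p.1 (i + 1) + p.1 (i + 2) = 0 := by
    intro p hp i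
    have := hsum p hp
    fin_cases i
    · exact this
    · change p.1 1 + p.1 2 + p.1 0 = 0
      linear_combination this
    · change p.1 2 + p.1 0 + p.1 1 = 0
      linear_combination this
  -- A screw motion with axis parallel to the `i`-th coordinate axis.
  have hex : ∀ i, ∃ p ∈ K, p.1 i = 0 ∧ p.1 (i + 1) = 1 := by
    intro i
    obtain ⟨p, hp, h⟩ := hT (i + 1)
    obtain ⟨q, hq, h'⟩ := hT (i + 2)
    have h := (zmod_two_cases _).resolve_left h
    have h' := (zmod_two_cases _).resolve_left h'
    have hq2 := hsum' q hq i
    rcases zmod_two_cases (p.1 i) with hpi | hpi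
    · exact ⟨p, hp, hpi, h⟩
    rcases zmod_two_cases (q.1 i) with hqi | hqi
    · refine ⟨q, hq, hqi, ?_⟩
      rw [hqi, h'] at hq2
      revert hq2
      generalize q.1 (i + 1) = b
      revert b
      decide
    · refine ⟨p + q, K.add_mem hp hq, ?_, ?_⟩
      · rw [Prod.fst_add, Pi.add_apply, hpi, hqi]
        decide
      · rw [Prod.fst_add, Pi.add_apply, h]
        rw [hqi, h'] at hq2
        revert hq2
        generalize q.1 (i + 1) = b
        revert b
        decide
  have hone : ∀ p ∈ K, ∀ i, p.1 i = 0 → p.1 (i + 1) = 1 → p.2 i = 1 := by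
    intro p hp i h h'
    obtain ⟨l, hl, hl'⟩ := hK p hp (by rintro rfl; simp at h')
    have h2 := hsum' p hp i
    have hcases : ∀ i l : Fin 3, l = i ∨ l = i + 1 ∨ l = i + 2 := by decide
    rcases hcases i l with rfl | rfl | rfl
    · exact hl'
    · exact absurd (hl.symm.trans h') zero_ne_one
    · rw [h, h', hl] at h2
      exact absurd h2 (by decide)
  choose u hu hu0 hu1 using hex
  have hzero : ∀ p ∈ K, p.1 = 0 → p.2 = 0 := by
    intro p hp h
    funext i
    have h1 := hone _ (K.add_mem hp (hu i)) i (by simp [h, hu0]) (by simp [h, hu1])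
    rw [Prod.snd_add, Pi.add_apply, hone _ (hu i) i (hu0 i) (hu1 i)] at h1
    exact add_eq_right.1 h1
  have a00 := hu0 0
  have a01 : (u 0).1 1 = 1 := hu1 0
  have a02 : (u 0).1 2 = 1 := by
    have := hsum _ (hu 0)
    rw [a00, a01, zero_add] at this
    exact (CharTwo.add_eq_zero.1 this).symm
  have a11 := hu0 1
  have a12 : (u 1).1 2 = 1 := hu1 1
  have a10 : (u 1).1 0 = 1 := by
    have := hsum _ (hu 1)
    rw [a11, a12, add_zero] at this
    exact CharTwo.add_eq_zero.1 this
  have b00 : (u 0).2 0 = 1 := hone _ (hu 0) 0 a00 a01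
  have b11 : (u 1).2 1 = 1 := hone _ (hu 1) 1 a11 a12
  have b2 : (u 0).2 2 + (u 1).2 2 = 1 := by
    refine hone _ (K.add_mem (hu 0) (hu 1)) 2 ?_ ?_
    · rw [Prod.fst_add, Pi.add_apply, a02, a12]
      decide
    · change (u 0).1 0 + (u 1).1 0 = 1
      rw [a00, a10, zero_add]
  have hmem : ∀ p, p ∈ K ↔ p = p.1 1 • u 0 + p.1 0 • u 1 ∧ p.1 0 + p.1 1 + p.1 2 = 0 := by
    intro p
    constructor
    · intro hp
      refine ⟨?_, hsum p hp⟩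
      have hmem := K.sub_mem hp (K.add_mem (smul_mem_of_mem (hu 0) (p.1 1))
        (smul_mem_of_mem (hu 1) (p.1 0)))
      have h1 : (p - (p.1 1 • u 0 + p.1 0 • u 1)).1 = 0 := by
        have h2 := hsum p hp
        funext l
        fin_cases l
        · simp [a00, a10]
        · simp [a01, a11]
        · simp only [Fin.reduceFinMk, Prod.fst_sub, Prod.fst_add, Prod.smul_fst, Pi.sub_apply,
            Pi.add_apply, Pi.smul_apply, smul_eq_mul, a02, a12, Pi.zero_apply]
          revert h2
          generalize p.1 0 = a
          generalize p.1 1 = b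
          generalize p.1 2 = d
          revert a b d
          decide
      exact sub_eq_zero.1 (Prod.ext h1 (hzero _ hmem h1))
    · rintro ⟨hp, -⟩
      rw [hp]
      exact K.add_mem (smul_mem_of_mem (hu 0) _) (smul_mem_of_mem (hu 1) _)
  refine ⟨![(u 1).2 0, (u 0).2 1 + 1, (u 0).2 2], fun p => ?_⟩
  rw [hmem, and_comm]
  refine and_congr_right fun hp => ?_
  have key0 : ∀ a b r : ZMod 2, b * 1 + a * r = b + r * a := by decide
  have key1 : ∀ a b d q : ZMod 2, a + b + d = 0 → b * q + a * 1 = d + (q + 1) * b := by decide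
  have key2 : ∀ a b d q s : ZMod 2, a + b + d = 0 → q + s = 1 →
      b * q + a * s = a + q * d := by decide
  have e0 : (p.1 1 • u 0 + p.1 0 • u 1).2 0 = p.1 1 + (u 1).2 0 * p.1 0 := by
    rw [← key0, ← b00]; rfl
  have e1 : (p.1 1 • u 0 + p.1 0 • u 1).2 1 = p.1 2 + ((u 0).2 1 + 1) * p.1 1 := by
    rw [← key1 _ _ _ _ hp, ← b11]; rfl
  have e2 : (p.1 1 • u 0 + p.1 0 • u 1).2 2 = p.1 0 + (u 0).2 2 * p.1 2 := by
    rw [← key2 _ _ _ _ _ hp b2]; rfl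
  constructor
  · intro h l
    rw [show p.2 l = (p.1 1 • u 0 + p.1 0 • u 1).2 l from congrArg (fun q => q.2 l) h]
    fin_cases l
    exacts [e0, e1, e2]
  · intro h
    refine Prod.ext (funext fun l => ?_) (funext fun l => ?_)
    · fin_cases l
      · simp [a00, a10]
      · simp [a01, a11]
      · simp only [Fin.reduceFinMk, Prod.fst_add, Prod.smul_fst,
          Pi.add_apply, Pi.smul_apply, smul_eq_mul, a02, a12]
        revert hp
        generalize p.1 0 = a
        generalize p.1 1 = b
        generalize p.1 2 = d
        revert a b d
        decide
    · rw [h l]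
      fin_cases l
      exacts [e0.symm, e1.symm, e2.symm]

theorem nonempty_homeomorph_hantzscheWendtManifold
    {K : AddSubgroup ((Fin 3 → ZMod 2) × (Fin 3 → ZMod 2))}
    (hsum : ∀ p ∈ K, p.1 0 + p.1 1 + p.1 2 = 0)
    (hK : ∀ p ∈ K, p ≠ 0 → ∃ j, p.1 j = 0 ∧ p.2 j = 1)
    (hT : ∀ j, ∃ p ∈ K, p.1 j ≠ 0) :
    Nonempty (OrbitSpace (motionGroup 2 K) ≃ₜ HantzscheWendtManifold) := by
  obtain ⟨τ, hτ⟩ := exists_mem_iff_cyclic_shift hsum hK hT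
  refine nonempty_orbitSpace_homeomorph (quarterSimilarity fun j => (τ j).val) fun x y => ?_
  have hq : ∀ (x : E3) (j : Fin 3), quarterSimilarity (fun j => ((τ j).val : ℝ)) x j =
    (x j + (τ j).val) / 4 := fun x j => rfl
  rw [hantzscheWendtGroup_eq, exists_motionGroup_apply_eq, exists_motionGroup_apply_eq]
  refine exists_congr fun a => ?_
  -- A motion about the shifted origin has its translation part shifted where the sign is `-1`.
  constructor
  · rintro ⟨w, h, hy⟩
    obtain ⟨h0, h1⟩ := (hτ _).1 h
    simp only at h0 h1
    have h2 : ∀ j, ((w j + (a j).val * (τ j).val : ℤ) : ZMod 2) = a (j + 1) := by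
      intro j
      push_cast
      rw [h1, ZMod.natCast_zmod_val, ZMod.natCast_zmod_val]
      linear_combination CharTwo.add_self_eq_zero (τ j * a j)
    refine ⟨fun j => w j + (a j).val * (τ j).val, ⟨h0, h2 0, h2 1, h2 2⟩, fun j => ?_⟩
    rw [hq, hq, hy, sgn_eq]
    push_cast
    ring
  · rintro ⟨w, ⟨h0, h1, h2, h3⟩, hy⟩
    simp only at h0 h1 h2 h3
    refine ⟨fun j => w j - (a j).val * (τ j).val, (hτ _).2 ⟨h0, fun j => ?_⟩, fun j => ?_⟩
    · have h4 : (w j : ZMod 2) = a (j + 1) := by fin_cases j <;> assumption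
      simp only
      push_cast
      rw [h4, ZMod.natCast_zmod_val, ZMod.natCast_zmod_val]
      linear_combination -CharTwo.add_self_eq_zero (τ j * a j)
    · have h4 := hy j
      rw [hq, hq, sgn_eq] at h4
      rw [sgn_eq]
      push_cast
      linear_combination 4 * h4

end CubeColouring

theorem mainTheorem2 (k : ℕ) (hk : 3 ≤ k) (c : Fin 6 → Fin k → ZMod 2)
    (hproper : CubeColouring.IsProper c)
    (horient : CubeColouring.IsOrientable (CubeColouring.kernelGroup c)) :
    (((CubeColouring.rowSpace (CubeColouring.definingMatrix c) : Set (Fin 6 → ZMod 2)) ∩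
        CubeColouring.T = CubeColouring.T) →
      Nonempty (CubeColouring.ColouringSpace c ≃ₜ CubeColouring.ThreeTorus)) ∧
    ((((CubeColouring.rowSpace (CubeColouring.definingMatrix c) : Set (Fin 6 → ZMod 2)) ∩
          CubeColouring.T).Nonempty ∧
        (CubeColouring.rowSpace (CubeColouring.definingMatrix c) : Set (Fin 6 → ZMod 2)) ∩
          CubeColouring.T ⊂ CubeColouring.T) →
      Nonempty (CubeColouring.ColouringSpace c ≃ₜ CubeColouring.HalfTwistManifold)) ∧
    (((CubeColouring.rowSpace (CubeColouring.definingMatrix c) : Set (Fin 6 → ZMod 2)) ∩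
        CubeColouring.T = ∅) →
      Nonempty (CubeColouring.ColouringSpace c ≃ₜ CubeColouring.HantzscheWendtManifold)) := by
  have hsum := fun p hp => CubeColouring.sum_eq_zero_of_isOrientable (p := p) horient hp
  have hK := fun p hp h => hproper.exists_eq_zero_and_eq_one (p := p) hp h
  change (_ → Nonempty (CubeColouring.OrbitSpace (CubeColouring.kernelGroup c) ≃ₜ _)) ∧
    (_ → Nonempty (CubeColouring.OrbitSpace (CubeColouring.kernelGroup c) ≃ₜ _)) ∧
    (_ → Nonempty (CubeColouring.OrbitSpace (CubeColouring.kernelGroup c) ≃ₜ _))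
  rw [CubeColouring.kernelGroup_eq]
  refine ⟨fun h => ?_, fun h => ?_, fun h => ?_⟩
  · refine CubeColouring.nonempty_homeomorph_threeTorus fun p hp => funext fun j => ?_
    have hT := Set.inter_eq_right.1 h ((CubeColouring.mem_T_iff _).2 ⟨j, rfl⟩)
    exact (CubeColouring.e_add_e_mem_rowSpace_iff c j).1 hT p hp
  · obtain ⟨⟨v, hv, hvT⟩, hne⟩ := h
    obtain ⟨j, rfl⟩ := (CubeColouring.mem_T_iff v).1 hvT
    obtain ⟨v', hv', hnot⟩ := Set.exists_of_ssubset hne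
    obtain ⟨i, rfl⟩ := (CubeColouring.mem_T_iff v').1 hv'
    have h2 : ¬∀ p ∈ (CubeColouring.motionColour c).ker, p.1 i = 0 := fun h3 => hnot ⟨(CubeColouring.e_add_e_mem_rowSpace_iff c i).2 h3, hv'⟩
    push Not at h2
    obtain ⟨u, hu, hui⟩ := h2
    exact CubeColouring.nonempty_homeomorph_halfTwistManifold hsum hK
      ((CubeColouring.e_add_e_mem_rowSpace_iff c j).1 hv) hu fun h4 => hui (congrFun h4 i)
  · refine CubeColouring.nonempty_homeomorph_hantzscheWendtManifold hsum hK fun j => ?_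
    have h2 : ¬∀ p ∈ (CubeColouring.motionColour c).ker, p.1 j = 0 := fun h3 =>
      Set.eq_empty_iff_forall_notMem.1 h _
      ⟨(CubeColouring.e_add_e_mem_rowSpace_iff c j).2 h3, (CubeColouring.mem_T_iff _).2 ⟨j, rfl⟩⟩
    push Not at h2
    exact h2
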